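/- Let $n$ be an odd positive integer. Let $\Omega_n^{t\&h}$ be the polytope of all real $n\times n$ doubly stochastic matrices $A=[a_{ij}]$ that are symmetric ($a_{ij}=a_{ji}$) and Hankel symmetric ($a_{ij}=a_{n+1-j,\,n+1-i}$). The loopy graph $G(A)$ of $A\in\Omega_n^{t\&h}$ has vertex set $\{1,\dots,n\}$ and one edge joining $i$ and $j$ exactly when $a_{ij}\neq 0$ (a loop if $i=j$). A loop counts as a cycle of length $1$; all other cycles have length at least $3$. Call $c=(n+1)/2$ the central vertex and let $\rho(i)=n+1-i$. If $A$ is an extreme point of $\Omega_n^{t\&h}$, then the connected component of $G(A)$ containing $c$ is of one of the following three types: (a) an odd cycle (possibly a loop) containing $c$; (b) two distinct odd cycles of the same length (possibly loops) and a path of even length (possibly zero) with $c$ at its centre that joins a vertex of one cycle to a vertex of the other, the cycles and the path being otherwise disjoint; if the path has length zero (so that the two cycles share exactly the vertex $c$), the two cycles are interchanged by $\rho$; (c) an even cycle (of length at least $4$) bisected by a path of even nonzero length with $c$ at its centre, that is, the path joins two opposite vertices of the cycle and is otherwise disjoint from it, and the two halves into which these vertices divide the cycle are interchanged by $\rho$.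 Conversely, every matrix in $\Omega_n^{t\&h}$ whose loopy graph is connected and is of type (a), (b) or (c) is an extreme point of $\Omega_n^{t\&h}$. -/

import Mathlib

open scoped Graph

/-- The Hankel transpose: reflection of a matrix about its antidiagonal. `Fin.rev i` is the index
written `n + 1 - i` when rows and columns are numbered from `1`. -/
def hankelTranspose {n : ℕ} (A : Matrix (Fin n) (Fin n) ℝ) : Matrix (Fin n) (Fin n) ℝ :=
  Matrix.of fun i j => A j.rev i.rev

/-- The polytope of symmetric and Hankel-symmetric doubly stochastic `n × n` matrices. -/
def OmegaTH (n : ℕ) : Set (Matrix (Fin n) (Fin n) ℝ) :=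
  {A | A ∈ doublyStochastic ℝ (Fin n) ∧ A.IsSymm ∧ hankelTranspose A = A}

/-- The loopy graph of a matrix: all indices are vertices, and there is one edge joining `i` and `j`
(a loop if `i = j`) exactly when the entry `(i, j)` is nonzero. The two orders of the indices are
both mentioned only so that the definition makes sense for all matrices; for a symmetric matrix the
two alternatives coincide. -/
def loopyGraph {n : ℕ} (A : Matrix (Fin n) (Fin n) ℝ) : Graph (Fin n) (Sym2 (Fin n)) where
  vertexSet := Set.univ
  IsLink e i j := e = s(i, j) ∧ (A i j ≠ 0 ∨ A j i ≠ 0)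
  isLink_symm := by
    intro e _
    refine ⟨fun i j h => ?_⟩
    exact ⟨h.1.trans Sym2.eq_swap, h.2.symm⟩
  eq_or_eq_of_isLink_of_isLink := by
    intro e x y v w h h'
    have h2 : s(x, y) = s(v, w) := h.1.symm.trans h'.1
    rw [Sym2.eq_iff] at h2
    rcases h2 with h2 | h2
    · exact Or.inl h2.1
    · exact Or.inr h2.1
  left_mem_of_isLink := fun _ _ _ _ => Set.mem_univ _

section Shapes

variable {V β : Type*}

/-- Two vertices are joined by a walk. -/
def GraphReachable (G : Graph V β) (u v : V) : Prop := Relation.ReflTransGen G.Adj u v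

/-- A graph is connected if it has a vertex and any two of its vertices are joined by a walk. -/
def GraphConnected (G : Graph V β) : Prop :=
  V(G).Nonempty ∧ ∀ u ∈ V(G), ∀ v ∈ V(G), GraphReachable G u v

/-- The connected component of `G` containing the vertex `c`. -/
def componentOf (G : Graph V β) (c : V) : Graph V β := G.induce {v | GraphReachable G c v}

/-- The edges `{w j, w (j + 1)}` of the cycle with vertices `w 0, …, w (k - 1)` in cyclic order.
For `k = 1` this is a single loop at `w 0`. -/
def cycleEdges {k : ℕ} (w : ZMod k → V) : Set (Sym2 V) := Set.range fun j => s(w j, w (j + 1))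

/-- The edges `{p i, p (i + 1)}` of the path with vertices `p 0, …, p l`. -/
def pathEdges {l : ℕ} (p : Fin (l + 1) → V) : Set (Sym2 V) :=
  Set.range fun i : Fin l => s(p i.castSucc, p i.succ)

/-- `H` has exactly the vertices in `S` and the adjacencies in `E`. -/
def ConsistsOf (H : Graph V β) (S : Set V) (E : Set (Sym2 V)) : Prop :=
  V(H) = S ∧ ∀ x y, H.Adj x y ↔ s(x, y) ∈ E

/-- Type (a): `H` is an odd cycle (possibly of length `1`, that is, a loop) containing `c`. -/
def IsTypeA (H : Graph V β) (c : V) : Prop :=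
  ∃ (k : ℕ) (w : ZMod k → V), Odd k ∧ Function.Injective w ∧ c ∈ Set.range w ∧
    ConsistsOf H (Set.range w) (cycleEdges w)

/-- Type (b): `H` consists of two distinct odd cycles `w`, `w'` of the same length `k` (loops if
`k = 1`) and a path `p` of even length `2 * s` (possibly `s = 0`) with centre `c`, which joins a
vertex of the first cycle to a vertex of the second; the cycles and the path share no vertices but
these. If the path has length zero, so that the two cycles share precisely the vertex `c`, the
reflection `ρ` interchanges the two cycles. -/
def IsTypeB (H : Graph V β) (c : V) (ρ : V → V) : Prop :=
  ∃ (k s : ℕ) (w w' : ZMod k → V) (p : Fin (2 * s + 1) → V),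
    Odd k ∧ Function.Injective w ∧ Function.Injective w' ∧ Function.Injective p ∧
    Set.range w ≠ Set.range w' ∧
    p 0 = w 0 ∧ p (Fin.last (2 * s)) = w' 0 ∧ p ⟨s, by omega⟩ = c ∧
    Set.range w ∩ Set.range p = {w 0} ∧ Set.range w' ∩ Set.range p = {w' 0} ∧
    Set.range w ∩ Set.range w' ⊆ Set.range p ∧
    (s = 0 → ρ '' Set.range w = Set.range w') ∧
    ConsistsOf H (Set.range w ∪ Set.range w' ∪ Set.range p)
      (cycleEdges w ∪ cycleEdges w' ∪ pathEdges p)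

/-- Type (c): `H` consists of a cycle `w` of even length `2 * l ≥ 4` and a path `p` of even nonzero
length `2 * s` with centre `c`, which joins two opposite vertices of the cycle and is otherwise
disjoint from it; the reflection `ρ` interchanges the two halves into which the ends of the path
divide the cycle. -/
def IsTypeC (H : Graph V β) (c : V) (ρ : V → V) : Prop :=
  ∃ (l s : ℕ) (w : ZMod (2 * l) → V) (p : Fin (2 * s + 1) → V),
    2 ≤ l ∧ 1 ≤ s ∧ Function.Injective w ∧ Function.Injective p ∧
    p 0 = w 0 ∧ p (Fin.last (2 * s)) = w (l : ZMod (2 * l)) ∧ p ⟨s, by omega⟩ = c ∧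
    Set.range w ∩ Set.range p = {w 0, w (l : ZMod (2 * l))} ∧
    ρ '' ((fun j : ℕ => w (j : ZMod (2 * l))) '' Set.Icc 0 l) =
      (fun j : ℕ => w (j : ZMod (2 * l))) '' Set.Icc l (2 * l) ∧
    ConsistsOf H (Set.range w ∪ Set.range p) (cycleEdges w ∪ pathEdges p)

end Shapes

/-- The vertex written `(n + 1) / 2` when the vertices are numbered from `1`; it is number
`(n - 1) / 2` when they are numbered from `0`. -/
def centralVertex {n : ℕ} (hn : Odd n) : Fin n :=
  ⟨(n - 1) / 2, by have := hn.pos; omega⟩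

/-- `H` is of one of the three types, with respect to the central vertex and the reflection
`i ↦ n + 1 - i` of the vertices. -/
def IsCentralType {n : ℕ} (hn : Odd n) (H : Graph (Fin n) (Sym2 (Fin n))) : Prop :=
  IsTypeA H (centralVertex hn) ∨ IsTypeB H (centralVertex hn) Fin.rev ∨
    IsTypeC H (centralVertex hn) Fin.rev

/-! Extremality is a support condition: `A` is extreme iff no nonzero symmetric, Hankel symmetric
`X` with zero row sums is supported in the support of `A` (`mem_extremePoints_OmegaTH_iff`). Both
directions are linear algebra on the edges of the graph.

Converse: on a cycle whose vertices see only cycle edges, zero row sums make the entries of `X`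
alternate in sign, so they vanish if the length is odd. On a path centred at `c`, the reflection
equates the two entries at `c`, and every entry is half the row sum. If two cycles meet at `c`, the
reflection balances each of them separately at `c`. For type (c), the reflection equates the first
entries of the two halves of the cycle; the half-length is odd, because the row sums of `A` itself
are inconsistent otherwise, and this forces `X = 0` (`eq_zero_of_typeB`, `typeC_entries`).

Forward: pass to the quotient by the reflection. An orbit of edges `xy` contributes the row sum
vector `orbitVector x + orbitVector y`, a column of the unsigned incidence matrix of the quotient
graph, and extremality says that no orbit depends on others (`not_realizes_edge`). As in the
even-cycle matroid, the component of `c` in the quotient then contains a single cycle, and this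
cycle is odd. In that component only `c` can be a leaf (`exists_other_neighbor`). So a walk from `c`
that never turns back away from `c` runs along a path and closes into a cycle: a lollipop
(`exists_isLollipop`). It is the whole component, as a further edge would be dependent or would lead
to a leaf (`IsLollipop.joined_iff_mem_support`). Unfolding the lollipop about `c` gives a symmetric
trail; the type depends on whether the walk closes at `v i` or at its reflection. -/

/-- `X` is symmetric and Hankel symmetric, and all its row sums are equal to `r`. -/
structure IsTH {n : ℕ} (r : ℝ) (X : Matrix (Fin n) (Fin n) ℝ) : Prop where
  symm : ∀ i j, X i j = X j i
  rev : ∀ i j, X i.rev j.rev = X i j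
  row : ∀ i, ∑ j, X i j = r

/-! ### Perturbations, extremality and sums with few nonzero terms -/

section Basic

variable {n : ℕ}

lemma mem_OmegaTH_iff {A : Matrix (Fin n) (Fin n) ℝ} :
    A ∈ OmegaTH n ↔ (∀ i j, 0 ≤ A i j) ∧ IsTH 1 A := by
  constructor
  · rintro ⟨h1, h2, h3⟩
    rw [mem_doublyStochastic_iff_sum] at h1
    have hs : ∀ i j, A i j = A j i := fun i j => h2.apply j i
    refine ⟨h1.1, hs, fun i j => ?_, h1.2.1⟩
    have := congrFun (congrFun h3 j) i
    simp only [hankelTranspose, Matrix.of_apply] at this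
    rw [this, hs]
  · rintro ⟨h0, h⟩
    refine ⟨mem_doublyStochastic_iff_sum.2 ⟨h0, h.row, fun j => ?_⟩, ?_, ?_⟩
    · rw [← h.row j]
      exact Finset.sum_congr rfl fun i _ => h.symm i j
    · ext i j
      exact h.symm j i
    · ext i j
      simp only [hankelTranspose, Matrix.of_apply]
      rw [h.rev, h.symm]

lemma loopyGraph_adj {A : Matrix (Fin n) (Fin n) ℝ} {r : ℝ} (hA : IsTH r A) (x y : Fin n) :
    (loopyGraph A).Adj x y ↔ A x y ≠ 0 := by
  constructor
  · rintro ⟨e, -, h | h⟩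
    · exact h
    · rwa [hA.symm]
  · exact fun h => ⟨s(x, y), rfl, Or.inl h⟩

lemma IsTH.linear {r r' : ℝ} {X Y : Matrix (Fin n) (Fin n) ℝ} (hX : IsTH r X) (hY : IsTH r' Y)
    (a b : ℝ) : IsTH (a * r + b * r') (a • X + b • Y) where
  symm i j := by simp [hX.symm i j, hY.symm i j]
  rev i j := by simp [hX.rev i j, hY.rev i j]
  row i := by
    simp [Finset.sum_add_distrib, ← Finset.mul_sum, hX.row i, hY.row i]

/-- Extremality of `A` means that no nonzero perturbation is supported in the support of `A`. -/
lemma mem_extremePoints_OmegaTH_iff {A : Matrix (Fin n) (Fin n) ℝ} (hA : A ∈ OmegaTH n) :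
    A ∈ Set.extremePoints ℝ (OmegaTH n) ↔
      ∀ X, IsTH 0 X → (∀ i j, X i j ≠ 0 → A i j ≠ 0) → X = 0 := by
  obtain ⟨hA0, hA1⟩ := mem_OmegaTH_iff.1 hA
  constructor
  · intro h X hX hs
    obtain ⟨ε, hε, hle⟩ : ∃ ε : ℝ, 0 < ε ∧ ∀ p : Fin n × Fin n, ε * |X p.1 p.2| ≤ A p.1 p.2 := by
      have key : ∀ p : Fin n × Fin n, ∀ᶠ ε in nhdsWithin (0 : ℝ) (Set.Ioi 0),
          ε * |X p.1 p.2| ≤ A p.1 p.2 := by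
        intro p
        by_cases hp : X p.1 p.2 = 0
        · simp [hp, hA0]
        · have hpos : 0 < A p.1 p.2 := lt_of_le_of_ne (hA0 _ _) (hs _ _ hp).symm
          have ht : Filter.Tendsto (fun ε : ℝ => ε * |X p.1 p.2|) (nhdsWithin 0 (Set.Ioi 0))
              (nhds (0 * |X p.1 p.2|)) :=
            ((continuous_id.mul continuous_const).tendsto 0).mono_left nhdsWithin_le_nhds
          rw [zero_mul] at ht
          exact (ht.eventually (gt_mem_nhds hpos)).mono fun _ h => h.le
      obtain ⟨ε, h1, h2⟩ := ((Filter.eventually_all.2 key).and self_mem_nhdsWithin).exists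
      exact ⟨ε, h2, h1⟩
    have hmem : ∀ σ : ℝ, |σ| = 1 → A + (σ * ε) • X ∈ OmegaTH n := by
      intro σ hσ
      refine mem_OmegaTH_iff.2 ⟨fun i j => ?_, ?_⟩
      · have h1 := hle (i, j)
        have h2 : |σ * ε * X i j| = ε * |X i j| := by
          rw [abs_mul, abs_mul, hσ, one_mul, abs_of_pos hε]
        have h3 := neg_abs_le (σ * ε * X i j)
        simp only [Matrix.add_apply, Matrix.smul_apply, smul_eq_mul]
        simp only at h1
        linarith
      · simpa using hA1.linear hX 1 (σ * ε)
    have h1 := hmem 1 (by simp)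
    have h2 := hmem (-1) (by simp)
    have h3 := h.2 h1 h2 ⟨1 / 2, 1 / 2, by norm_num, by norm_num, by norm_num, by
      ext i j
      simp only [Matrix.add_apply, Matrix.smul_apply, smul_eq_mul]
      ring⟩
    ext i j
    have h4 := congrFun (congrFun h3 i) j
    simp only [Matrix.add_apply, Matrix.smul_apply, smul_eq_mul, one_mul] at h4
    have h5 : ε * X i j = 0 := by linarith
    simpa [hε.ne'] using h5
  · intro h
    refine ⟨hA, ?_⟩
    rintro B hB C hC ⟨a, b, ha, hb, hab, rfl⟩
    obtain ⟨hB0, hB1⟩ := mem_OmegaTH_iff.1 hB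
    obtain ⟨hC0, hC1⟩ := mem_OmegaTH_iff.1 hC
    -- Entries are nonnegative, so `B` and `C` vanish wherever `A` does; their difference is an
    -- admissible perturbation.
    have hX : (1 : ℝ) • B + (-1 : ℝ) • C = 0 := by
      refine h _ (by simpa using hB1.linear hC1 1 (-1)) fun i j hne h0 => hne ?_
      have e1 := hB0 i j
      have e2 := hC0 i j
      simp only [Matrix.add_apply, Matrix.smul_apply, smul_eq_mul] at h0 ⊢
      have e3 : a * B i j = 0 := by nlinarith [mul_nonneg ha.le e1, mul_nonneg hb.le e2]
      have e4 : b * C i j = 0 := by nlinarith [mul_nonneg ha.le e1, mul_nonneg hb.le e2]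
      have e5 : B i j = 0 := by simpa [ha.ne'] using e3
      have e6 : C i j = 0 := by simpa [hb.ne'] using e4
      simp [e5, e6]
    have hBC : B = C := by
      rw [one_smul, neg_one_smul] at hX
      exact add_neg_eq_zero.1 hX
    subst hBC
    rw [← add_smul, hab, one_smul]

lemma rev_centralVertex (hn : Odd n) : (centralVertex hn).rev = centralVertex hn := by
  obtain ⟨m, rfl⟩ := hn
  ext
  simp [centralVertex, Fin.val_rev]
  omega

lemma rev_eq_self_iff (hn : Odd n) (x : Fin n) : x.rev = x ↔ x = centralVertex hn := by
  refine ⟨fun h => ?_, fun h => h ▸ rev_centralVertex hn⟩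
  obtain ⟨m, rfl⟩ := hn
  have := congrArg Fin.val h
  ext
  simp only [Fin.val_rev, centralVertex] at this ⊢
  omega

lemma sum_eq_pair {f : Fin n → ℝ} {a b : Fin n} (hab : a ≠ b)
    (h : ∀ y, f y ≠ 0 → y = a ∨ y = b) : ∑ y, f y = f a + f b := by
  rw [← Finset.sum_pair hab]
  refine (Finset.sum_subset (Finset.subset_univ _) fun y _ hy => ?_).symm
  by_contra h0
  exact hy (by simpa using h y h0)

/-- The case `a = b` is included so that loops can be treated as cycles of length 1. -/
lemma add_eq_zero_of_sum_eq_zero {f : Fin n → ℝ} {a b : Fin n}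
    (h : ∀ y, f y ≠ 0 → y = a ∨ y = b) (h0 : ∑ y, f y = 0) : f a + f b = 0 := by
  by_cases hab : a = b
  · subst hab
    rw [Finset.sum_eq_single a (fun y _ hy => by
      by_contra h1
      exact hy (by simpa using h y h1)) (by simp)] at h0
    rw [h0, add_zero]
  · rw [← sum_eq_pair hab h, h0]

lemma sum_eq_triple {f : Fin n → ℝ} {a b c : Fin n} (hab : a ≠ b) (hac : a ≠ c) (hbc : b ≠ c)
    (h : ∀ y, f y ≠ 0 → y = a ∨ y = b ∨ y = c) : ∑ y, f y = f a + f b + f c := by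
  have : ∑ y ∈ {a, b, c}, f y = f a + f b + f c := by
    rw [Finset.sum_insert (by simp [hab, hac]), Finset.sum_pair hbc]
    ring
  rw [← this]
  refine (Finset.sum_subset (Finset.subset_univ _) fun y _ hy => ?_).symm
  by_contra h0
  exact hy (by simpa using h y h0)

end Basic

/-! ### Edges of cycles and paths -/

section Edges

variable {V : Type*}

lemma cycleEdges_left_mem {k : ℕ} {w : ZMod k → V} {x y : V} (h : s(x, y) ∈ cycleEdges w) :
    x ∈ Set.range w := by
  obtain ⟨j, hj⟩ := h
  rcases Sym2.eq_iff.1 hj with h | h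
  · exact ⟨_, h.1⟩
  · exact ⟨_, h.2⟩

lemma cycleEdges_right_mem {k : ℕ} {w : ZMod k → V} {x y : V} (h : s(x, y) ∈ cycleEdges w) :
    y ∈ Set.range w :=
  cycleEdges_left_mem (Sym2.eq_swap ▸ h)

lemma eq_or_eq_of_mem_cycleEdges {k : ℕ} {w : ZMod k → V} (hw : Function.Injective w) {j : ZMod k}
    {y : V} (h : s(w j, y) ∈ cycleEdges w) : y = w (j + 1) ∨ y = w (j - 1) := by
  obtain ⟨i, hi⟩ := h
  rcases Sym2.eq_iff.1 hi with h | h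
  · left
    rw [← hw h.1, h.2]
  · right
    rw [← hw h.2, ← h.1, add_sub_cancel_right]

/-- Replacing the index type of a path by the natural numbers. -/
lemma exists_natPath {m : ℕ} {p : Fin (m + 1) → V} (hp : Function.Injective p) :
    ∃ P : ℕ → V, (∀ i (h : i < m + 1), P i = p ⟨i, h⟩) ∧
      (∀ i j, i ≤ m → j ≤ m → P i = P j → i = j) ∧
      (∀ x, x ∈ Set.range p ↔ ∃ i ≤ m, P i = x) ∧
      (∀ e, e ∈ pathEdges p ↔ ∃ i < m, s(P i, P (i + 1)) = e) := by
  have key : ∀ i (h : i < m + 1), p ⟨min i m, by omega⟩ = p ⟨i, h⟩ := by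
    intro i h
    congr 2
    omega
  refine ⟨fun i => p ⟨min i m, by omega⟩, key, fun i j hi hj h => ?_, fun x => ?_, fun e => ?_⟩
  · have := congrArg Fin.val (hp h)
    simp only at this
    omega
  · constructor
    · rintro ⟨i, rfl⟩
      exact ⟨i, by omega, key i i.2⟩
    · rintro ⟨i, -, rfl⟩
      exact ⟨_, rfl⟩
  · constructor
    · rintro ⟨i, rfl⟩
      exact ⟨i, i.2, by simp only; rw [key i (by omega), key (i + 1) (by omega)]; rfl⟩
    · rintro ⟨i, hi, rfl⟩
      refine ⟨⟨i, hi⟩, ?_⟩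
      simp only
      rw [key i (by omega), key (i + 1) (by omega)]
      rfl

end Edges

/-! ### Alternating functions on a cycle -/

section Alternating

/-- Nothing is assumed at `0`: this is where a path or a second cycle may be attached. -/
lemma alternating_apply {k : ℕ} {x : ZMod k → ℝ} (h : ∀ j ≠ 0, x (j - 1) + x j = 0) (m : ℕ)
    (hm : m < k) : x m = (-1) ^ m * x 0 := by
  induction m with
  | zero => simp
  | succ m ih =>
    have hne : ((m + 1 : ℕ) : ZMod k) ≠ 0 := by
      rw [Ne, ZMod.natCast_eq_zero_iff]
      exact fun hd => absurd (Nat.le_of_dvd (by omega) hd) (by omega)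
    have h1 := h _ hne
    have h2 : ((m + 1 : ℕ) : ZMod k) - 1 = (m : ℕ) := by push_cast; ring
    rw [h2, ih (by omega)] at h1
    rw [pow_succ]
    linarith

lemma alternating_eq_zero {k : ℕ} [NeZero k] {x : ZMod k → ℝ}
    (h : ∀ j ≠ 0, x (j - 1) + x j = 0) (h0 : x 0 = 0) (j : ZMod k) : x j = 0 := by
  have := alternating_apply h j.val j.val_lt
  rwa [ZMod.natCast_zmod_val, h0, mul_zero] at this

lemma alternating_neg_one {k : ℕ} (hk : Odd k) {x : ZMod k → ℝ}
    (h : ∀ j ≠ 0, x (j - 1) + x j = 0) : x (-1) = x 0 := by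
  obtain ⟨m, rfl⟩ := hk
  have := alternating_apply h (2 * m) (by omega)
  have h2 : ((2 * m : ℕ) : ZMod (2 * m + 1)) = -1 := by
    rw [eq_neg_iff_add_eq_zero]
    exact_mod_cast ZMod.natCast_self (2 * m + 1)
  rw [h2] at this
  simpa using this

end Alternating

/-! ### Graphs of the three types come from extreme points -/

section Converse

variable {n : ℕ} {X : Matrix (Fin n) (Fin n) ℝ}

lemma eq_zero_of_mem_cycleEdges {r : ℝ} (hX : IsTH r X) {k : ℕ} {w : ZMod k → Fin n}
    (h : ∀ j, X (w j) (w (j + 1)) = 0) {x y : Fin n} (hxy : s(x, y) ∈ cycleEdges w) :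
    X x y = 0 := by
  obtain ⟨j, hj⟩ := hxy
  rcases Sym2.eq_iff.1 hj with ⟨rfl, rfl⟩ | ⟨rfl, rfl⟩
  · exact h j
  · rw [hX.symm, h]

lemma IsTH.cycle_step (hX : IsTH 0 X) {k : ℕ} {w : ZMod k → Fin n} (j : ZMod k)
    (h : ∀ y, X (w j) y ≠ 0 → y = w (j + 1) ∨ y = w (j - 1)) :
    X (w (j - 1)) (w (j - 1 + 1)) + X (w j) (w (j + 1)) = 0 := by
  have := add_eq_zero_of_sum_eq_zero h (hX.row (w j))
  rw [sub_add_cancel, hX.symm (w (j - 1))]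
  linarith

/-- Alternation along an odd cycle makes the two entries at `w 0` equal, while their sum is zero. -/
lemma IsTH.odd_cycle_eq_zero (hX : IsTH 0 X) {k : ℕ} (hk : Odd k) {w : ZMod k → Fin n}
    (h : ∀ j y, X (w j) y ≠ 0 → y = w (j + 1) ∨ y = w (j - 1)) (j : ZMod k) :
    X (w j) (w (j + 1)) = 0 := by
  have : NeZero k := ⟨hk.pos.ne'⟩
  have hs := fun j => hX.cycle_step j (h j)
  refine alternating_eq_zero (x := fun j => X (w j) (w (j + 1))) (fun j _ => hs j) ?_ j
  have h1 := alternating_neg_one (x := fun j => X (w j) (w (j + 1))) hk (fun j _ => hs j)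
  have h2 := hs 0
  rw [zero_sub] at h2
  change X (w 0) (w (0 + 1)) = 0
  linarith

/-- On a path with the fixed vertex at its centre, all entries are half of the row sum. -/
lemma IsTH.path_entries (hn : Odd n) {r : ℝ} (hX : IsTH r X) {R : Fin n → Fin n → Prop}
    (hR : ∀ x y, R x y → R x.rev y.rev) (hsupp : ∀ x y, X x y ≠ 0 → R x y)
    {s : ℕ} {P : ℕ → Fin n}
    (hP : ∀ i j, i ≤ 2 * s → j ≤ 2 * s → P i = P j → i = j)
    (hnb : ∀ i, 0 < i → i < 2 * s → ∀ y, R (P i) y → y = P (i - 1) ∨ y = P (i + 1))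
    (hadj : 0 < s → R (P s) (P (s - 1))) (hc : P s = centralVertex hn) (i : ℕ) (hi : i < 2 * s) :
    X (P i) (P (i + 1)) = r / 2 := by
  have hs : 0 < s := by omega
  have step : ∀ i, 0 < i → i < 2 * s → X (P (i - 1)) (P i) + X (P i) (P (i + 1)) = r := by
    intro i h0 h1
    rw [← hX.row (P i), sum_eq_pair (a := P (i - 1)) (b := P (i + 1)) _
      fun y hy => hnb i h0 h1 y (hsupp _ _ hy), hX.symm (P (i - 1))]
    intro h
    have := hP _ _ (by omega) (by omega) h
    omega
  -- The reflection fixes the centre and no other vertex, so it interchanges the two neighbours of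
  -- the centre on the path. The argument runs in `R` because `X` may vanish on these edges.
  have hrev : (P (s - 1)).rev = P (s + 1) := by
    have h1 := hR _ _ (hadj hs)
    rw [hc, rev_centralVertex hn, ← hc] at h1
    refine (hnb s hs (by omega) _ h1).resolve_left fun h2 => ?_
    rw [rev_eq_self_iff hn, ← hc] at h2
    have := hP _ _ (by omega) (by omega) h2
    omega
  have heq : X (P (s - 1)) (P s) = X (P s) (P (s + 1)) := by
    rw [← hX.rev, hrev, hc, rev_centralVertex hn, hX.symm]
  have hstep := step s hs (by omega)
  -- Both entries at the centre are `r / 2`, and `step` carries this value outwards in either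
  -- direction.
  have up : ∀ d, s + d < 2 * s → X (P (s + d)) (P (s + d + 1)) = r / 2 := by
    intro d
    induction d with
    | zero => intro _; simp only [add_zero]; linarith
    | succ d ih =>
      intro h
      have h1 := step (s + d + 1) (by omega) (by omega)
      have h2 := ih (by omega)
      rw [Nat.add_sub_cancel] at h1
      rw [← add_assoc]
      linarith
  have down : ∀ d, d < s → X (P (s - 1 - d)) (P (s - 1 - d + 1)) = r / 2 := by
    intro d
    induction d with
    | zero =>
      intro _
      simp only [Nat.sub_zero, Nat.sub_add_cancel hs]
      linarith
    | succ d ih =>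
      intro h
      have h1 := step (s - 1 - d) (by omega) (by omega)
      have h2 := ih (by omega)
      have h3 : s - 1 - (d + 1) = s - 1 - d - 1 := by omega
      rw [h3, Nat.sub_add_cancel (by omega)]
      linarith
  rcases le_or_gt s i with h | h
  · obtain ⟨d, rfl⟩ := Nat.exists_eq_add_of_le h
    exact up d hi
  · have := down (s - 1 - i) (by omega)
    rwa [show s - 1 - (s - 1 - i) = i by omega] at this

lemma path_neighbor {V : Type*} {P : ℕ → V} {m i : ℕ} {y : V}
    (hP : ∀ i j, i ≤ m → j ≤ m → P i = P j → i = j) (hi : i ≤ m)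
    (h : ∃ j < m, s(P j, P (j + 1)) = s(P i, y)) :
    (i < m ∧ y = P (i + 1)) ∨ (0 < i ∧ y = P (i - 1)) := by
  obtain ⟨j, hj, h⟩ := h
  rcases Sym2.eq_iff.1 h with ⟨h1, h2⟩ | ⟨h1, h2⟩
  · have := hP _ _ (by omega) hi h1
    subst this
    exact Or.inl ⟨hj, h2.symm⟩
  · have := hP _ _ (by omega) hi h2
    subst this
    exact Or.inr ⟨by omega, by simpa using h1.symm⟩

/-- The path entries vanish first. If the path is nontrivial, the cycles are disjoint and each
vanishes by oddness. If it is trivial, the row of the centre is split between the cycles by means of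
the reflection. -/
lemma eq_zero_of_typeB (hn : Odd n) (hX : IsTH 0 X) {k s : ℕ} {w w' : ZMod k → Fin n}
    {p : Fin (2 * s + 1) → Fin n} (hk : Odd k) (hw : Function.Injective w)
    (hw' : Function.Injective w') (hp : Function.Injective p) (hne : Set.range w ≠ Set.range w')
    (h0 : p 0 = w 0) (hlast : p (Fin.last (2 * s)) = w' 0)
    (hc : p ⟨s, by omega⟩ = centralVertex hn)
    (hwp : Set.range w ∩ Set.range p = {w 0}) (hwp' : Set.range w' ∩ Set.range p = {w' 0})
    (hww : Set.range w ∩ Set.range w' ⊆ Set.range p)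
    (hs0 : s = 0 → Fin.rev '' Set.range w = Set.range w')
    (hE : ∀ x y, s(x, y) ∈ cycleEdges w ∪ cycleEdges w' ∪ pathEdges p →
      s(x.rev, y.rev) ∈ cycleEdges w ∪ cycleEdges w' ∪ pathEdges p)
    (hsupp : ∀ x y, X x y ≠ 0 → s(x, y) ∈ cycleEdges w ∪ cycleEdges w' ∪ pathEdges p) :
    X = 0 := by
  have : NeZero k := ⟨hk.pos.ne'⟩
  obtain ⟨P, hPp, hP, hPr, hPe⟩ := exists_natPath hp
  have hP0 : P 0 = w 0 := by rw [hPp 0 (by omega), ← h0]; rfl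
  have hPl : P (2 * s) = w' 0 := by rw [hPp _ (by omega), ← hlast]; rfl
  have hPs : P s = centralVertex hn := by rw [hPp _ (by omega), ← hc]
  have hwp1 : ∀ j, w j ∈ Set.range p → j = 0 := fun j hj =>
    hw (hwp.subset ⟨⟨j, rfl⟩, hj⟩)
  have hwp1' : ∀ j, w' j ∈ Set.range p → j = 0 := fun j hj =>
    hw' (hwp'.subset ⟨⟨j, rfl⟩, hj⟩)
  have hww1 : ∀ j, w j ∈ Set.range w' → j = 0 := fun j hj => hwp1 j (hww ⟨⟨j, rfl⟩, hj⟩)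
  have hww1' : ∀ j, w' j ∈ Set.range w → j = 0 := fun j hj => hwp1' j (hww ⟨hj, ⟨j, rfl⟩⟩)
  have hpath : ∀ i < 2 * s, X (P i) (P (i + 1)) = 0 := by
    intro i hi
    rw [hX.path_entries hn (R := fun x y => s(x, y) ∈ cycleEdges w ∪ cycleEdges w' ∪ pathEdges p)
      hE hsupp hP _ _ hPs i hi, zero_div]
    · intro i hi0 hi1 y hy
      have hir : P i ∈ Set.range p := (hPr _).2 ⟨i, hi1.le, rfl⟩
      rcases hy with (hy | hy) | hy
      · obtain ⟨j, hj⟩ := cycleEdges_left_mem hy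
        have hj0 := hwp1 j (hj ▸ hir)
        rw [hj0, ← hP0] at hj
        have := hP _ _ (by omega) (by omega) hj
        omega
      · obtain ⟨j, hj⟩ := cycleEdges_left_mem hy
        have hj0 := hwp1' j (hj ▸ hir)
        rw [hj0, ← hPl] at hj
        have := hP _ _ (by omega) (by omega) hj
        omega
      · rcases path_neighbor hP hi1.le ((hPe _).1 hy) with h | h
        · exact Or.inr h.2
        · exact Or.inl h.2
    · intro hs
      refine Or.inr ((hPe _).2 ⟨s - 1, by omega, ?_⟩)
      rw [Nat.sub_add_cancel hs]
      exact Sym2.eq_swap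
  have hpz : ∀ {x y}, s(x, y) ∈ pathEdges p → X x y = 0 := by
    intro x y h
    obtain ⟨i, hi, h⟩ := (hPe _).1 h
    rcases Sym2.eq_iff.1 h with ⟨rfl, rfl⟩ | ⟨rfl, rfl⟩
    · exact hpath i hi
    · rw [hX.symm, hpath i hi]
  have hs2 : ∀ x y, X x y ≠ 0 → s(x, y) ∈ cycleEdges w ∨ s(x, y) ∈ cycleEdges w' := by
    intro x y h
    exact (hsupp x y h).resolve_right fun h1 => h (hpz h1)
  have hnb : ∀ j ≠ 0, ∀ y, X (w j) y ≠ 0 → y = w (j + 1) ∨ y = w (j - 1) := by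
    intro j hj y hy
    rcases hs2 _ _ hy with h | h
    · exact eq_or_eq_of_mem_cycleEdges hw h
    · exact absurd (hww1 j (cycleEdges_left_mem h)) hj
  rcases Nat.eq_zero_or_pos s with rfl | hs
  · have hc0 : w 0 = centralVertex hn := by rw [← hP0, hPs]
    have hc0' : w' 0 = centralVertex hn := by rw [← hPl]; exact hPs
    -- For `k = 1` both cycles would be the loop at the centre, but they are distinct.
    have hk1 : (1 : ZMod k) ≠ 0 := by
      intro h1
      have hall : ∀ j : ZMod k, j = 0 := fun j => by rw [← mul_one j, h1, mul_zero]
      refine hne (Set.Subset.antisymm ?_ ?_)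
      · rintro _ ⟨j, rfl⟩
        exact ⟨0, by rw [hall j, hc0, hc0']⟩
      · rintro _ ⟨j, rfl⟩
        exact ⟨0, by rw [hall j, hc0, hc0']⟩
    have hloop : ∀ {u : ZMod k → Fin n}, Function.Injective u → s(u 0, u 0) ∉ cycleEdges u := by
      intro u hu h
      rcases eq_or_eq_of_mem_cycleEdges hu h with h | h
      · exact hk1 (by simpa using (hu h).symm)
      · exact hk1 (by simpa using (hu h).symm)
    have hcc : X (w 0) (w 0) = 0 := by
      by_contra h
      rcases hs2 _ _ h with h | h
      · exact hloop hw h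
      · rw [hc0, ← hc0'] at h
        exact hloop hw' h
    have himg : ∀ y, y ∈ Set.range w ↔ y.rev ∈ Set.range w' := by
      intro y
      rw [← hs0 rfl]
      exact (Function.Injective.mem_set_image Fin.rev_injective).symm
    have himg' : ∀ y, y ∈ Set.range w' ↔ y.rev ∈ Set.range w := by
      intro y
      rw [himg, Fin.rev_rev]
    classical
    -- The row of the centre is invariant under the reflection, which interchanges its parts on `w`
    -- and on `w'`. The two parts have equal sums, so each sum is zero and `w` is balanced at `w 0`
    -- on its own.
    have hg := add_eq_zero_of_sum_eq_zero (a := w 1) (b := w (-1))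
      (f := fun y => if y ∈ Set.range w then X (w 0) y else 0) (fun y hy => by
        have hy1 : y ∈ Set.range w := by
          by_contra h
          simp only [if_neg h] at hy
          exact hy rfl
        simp only [if_pos hy1] at hy
        rcases hs2 _ _ hy with h | h
        · simpa using eq_or_eq_of_mem_cycleEdges hw h
        · obtain ⟨j, rfl⟩ := hy1
          have := hww1 j (cycleEdges_right_mem h)
          subst this
          exact absurd hcc hy) (by
        have h1 : ∀ y, X (w 0) y = (if y ∈ Set.range w then X (w 0) y else 0) +
            (if y.rev ∈ Set.range w then X (w 0) y.rev else 0) := by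
          intro y
          have hy : X (w 0) y.rev = X (w 0) y := by
            rw [← hX.rev (w 0) y, hc0, rev_centralVertex hn]
          rw [hy]
          by_cases h1 : y ∈ Set.range w
          · by_cases h2 : y.rev ∈ Set.range w
            · obtain ⟨j, rfl⟩ := h1
              have := hww1 j ((himg' _).2 h2)
              subst this
              simp [hcc]
            · rw [if_pos h1, if_neg h2, add_zero]
          · by_cases h2 : y.rev ∈ Set.range w
            · rw [if_neg h1, if_pos h2, zero_add]
            · rw [if_neg h1, if_neg h2, add_zero]
              by_contra h
              rcases hs2 _ _ h with h | h
              · exact h1 (cycleEdges_right_mem h)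
              · exact h2 ((himg' _).1 (cycleEdges_right_mem h))
        have h2 := hX.row (w 0)
        have h3 := Equiv.sum_comp Fin.revPerm
          (fun y => if y ∈ Set.range w then X (w 0) y else 0)
        simp only [Fin.revPerm_apply] at h3
        rw [Finset.sum_congr rfl fun y _ => h1 y, Finset.sum_add_distrib, h3] at h2
        linarith)
    simp only [Set.mem_range_self, if_true] at hg
    have hs := fun j hj => hX.cycle_step j (hnb j hj)
    have hx1 := alternating_neg_one (x := fun j => X (w j) (w (j + 1))) hk hs
    simp only [neg_add_cancel, zero_add] at hx1
    rw [hX.symm] at hx1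
    have hz : ∀ j, X (w j) (w (j + 1)) = 0 :=
      alternating_eq_zero (x := fun j => X (w j) (w (j + 1))) hs
        (by simp only [zero_add]; linarith)
    ext x y
    by_contra h
    rcases hs2 _ _ h with h1 | h1
    · exact h (eq_zero_of_mem_cycleEdges hX hz h1)
    -- An entry on `w'` equals its reflection, which lies on `w`.
    · have hx := (himg' _).1 (cycleEdges_left_mem h1)
      have hy := (himg' _).1 (cycleEdges_right_mem h1)
      have h2 : X x.rev y.rev ≠ 0 := by rw [hX.rev]; exact h
      rcases hs2 _ _ h2 with h3 | h3
      · exact h2 (eq_zero_of_mem_cycleEdges hX hz h3)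
      · obtain ⟨i, hi⟩ := hx
        obtain ⟨j, hj⟩ := hy
        have hi0 := hww1 i (hi ▸ cycleEdges_left_mem h3)
        have hj0 := hww1 j (hj ▸ cycleEdges_right_mem h3)
        rw [← hi, ← hj, hi0, hj0] at h2
        exact h2 hcc
  · have hdis : ∀ i j, w i ≠ w' j := by
      intro i j h
      have hi := hww1 i ⟨j, h.symm⟩
      have hj := hww1' j ⟨i, h⟩
      rw [hi, hj, ← hP0, ← hPl] at h
      have := hP _ _ (by omega) (by omega) h
      omega
    have hz := hX.odd_cycle_eq_zero hk (w := w) fun j y hy => by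
      rcases hs2 _ _ hy with h | h
      · exact eq_or_eq_of_mem_cycleEdges hw h
      · obtain ⟨i, hi⟩ := cycleEdges_left_mem h
        exact absurd hi.symm (hdis _ _)
    have hz' := hX.odd_cycle_eq_zero hk (w := w') fun j y hy => by
      rcases hs2 _ _ hy with h | h
      · obtain ⟨i, hi⟩ := cycleEdges_left_mem h
        exact absurd hi (hdis _ _)
      · exact eq_or_eq_of_mem_cycleEdges hw' h
    ext x y
    by_contra h
    rcases hs2 _ _ h with h1 | h1
    · exact h (eq_zero_of_mem_cycleEdges hX hz h1)
    · exact h (eq_zero_of_mem_cycleEdges hX hz' h1)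

/-- Each end of the path spends `r / 2` on its path edge, leaving `r / 2` for its two cycle edges.
The row sum `r` is kept general: `r = 1` applies to `A` and yields the parity of `l`, `r = 0`
applies to perturbations. -/
lemma typeC_entries (hn : Odd n) {r : ℝ} (hX : IsTH r X) {l s : ℕ} {w : ZMod (2 * l) → Fin n}
    {p : Fin (2 * s + 1) → Fin n} (hl : 2 ≤ l) (hs : 1 ≤ s) (hw : Function.Injective w)
    (hp : Function.Injective p) (h0 : p 0 = w 0)
    (hlast : p (Fin.last (2 * s)) = w (l : ZMod (2 * l)))
    (hc : p ⟨s, by omega⟩ = centralVertex hn)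
    (hwp : Set.range w ∩ Set.range p = {w 0, w (l : ZMod (2 * l))})
    (hρ : Fin.rev '' ((fun j : ℕ => w (j : ZMod (2 * l))) '' Set.Icc 0 l) =
      (fun j : ℕ => w (j : ZMod (2 * l))) '' Set.Icc l (2 * l))
    (hE : ∀ x y, s(x, y) ∈ cycleEdges w ∪ pathEdges p →
      s(x.rev, y.rev) ∈ cycleEdges w ∪ pathEdges p)
    (hsupp : ∀ x y, X x y ≠ 0 → s(x, y) ∈ cycleEdges w ∪ pathEdges p) :
    (∀ x y, s(x, y) ∈ pathEdges p → X x y = r / 2) ∧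
    (∀ j : ZMod (2 * l), X (w (j - 1)) (w (j - 1 + 1)) + X (w j) (w (j + 1)) =
      if j = 0 ∨ j = l then r / 2 else r) ∧
    X (w l) (w (l + 1)) = X (w 0) (w (0 + 1)) := by
  obtain ⟨P, hPp, hP, hPr, hPe⟩ := exists_natPath hp
  have hP0 : P 0 = w 0 := by rw [hPp 0 (by omega), ← h0]; rfl
  have hPl : P (2 * s) = w l := by rw [hPp _ (by omega), ← hlast]; rfl
  have hPs : P s = centralVertex hn := by rw [hPp _ (by omega), ← hc]
  have hcast : ∀ a b : ℕ, (a : ZMod (2 * l)) = b ↔ a % (2 * l) = b % (2 * l) :=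
    fun a b => ZMod.natCast_eq_natCast_iff' a b _
  have hl0 : (l : ZMod (2 * l)) ≠ 0 := by
    rw [Ne, ← Nat.cast_zero, hcast, Nat.mod_eq_of_lt (by omega : l < 2 * l)]
    simp
    omega
  have hwp1 : ∀ j, w j ∈ Set.range p → j = 0 ∨ j = l := fun j hj => by
    rcases hwp.subset ⟨⟨j, rfl⟩, hj⟩ with h | h
    · exact Or.inl (hw h)
    · exact Or.inr (hw h)
  have hint : ∀ i, 0 < i → i < 2 * s → P i ∉ Set.range w := by
    rintro i hi0 hi1 ⟨j, hj⟩
    rcases hwp1 j (hj ▸ (hPr _).2 ⟨i, hi1.le, rfl⟩) with rfl | rfl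
    · rw [← hP0] at hj
      have := hP _ _ (by omega) (by omega) hj
      omega
    · rw [← hPl] at hj
      have := hP _ _ (by omega) (by omega) hj
      omega
  have hpl : ∀ {x y}, s(x, y) ∈ pathEdges p → x ∈ Set.range p := by
    intro x y h
    obtain ⟨i, hi, h⟩ := (hPe _).1 h
    rw [hPr]
    rcases Sym2.eq_iff.1 h with h | h
    · exact ⟨i, by omega, h.1⟩
    · exact ⟨i + 1, by omega, h.2⟩
  have hpath : ∀ i < 2 * s, X (P i) (P (i + 1)) = r / 2 := by
    refine hX.path_entries hn (R := fun x y => s(x, y) ∈ cycleEdges w ∪ pathEdges p)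
      hE hsupp hP ?_ ?_ hPs
    · intro i hi0 hi1 y hy
      rcases hy with hy | hy
      · exact absurd (cycleEdges_left_mem hy) (hint i hi0 hi1)
      · rcases path_neighbor hP hi1.le ((hPe _).1 hy) with h | h
        · exact Or.inr h.2
        · exact Or.inl h.2
    · intro hs
      refine Or.inr ((hPe _).2 ⟨s - 1, by omega, ?_⟩)
      rw [Nat.sub_add_cancel hs]
      exact Sym2.eq_swap
  have hne2 : ∀ j : ZMod (2 * l), w (j + 1) ≠ w (j - 1) := by
    intro j h
    have h1 : ((2 : ℕ) : ZMod (2 * l)) = (0 : ℕ) := by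
      have := hw h
      push_cast
      linear_combination this
    rw [hcast, Nat.mod_eq_of_lt (by omega)] at h1
    simp at h1
  have nb0 : ∀ y, s(w 0, y) ∈ cycleEdges w ∪ pathEdges p →
      y = w (0 + 1) ∨ y = w (0 - 1) ∨ y = P 1 := by
    rintro y (hy | hy)
    · rcases eq_or_eq_of_mem_cycleEdges hw hy with h | h
      · exact Or.inl h
      · exact Or.inr (Or.inl h)
    · rw [← hP0] at hy
      rcases path_neighbor hP (by omega) ((hPe _).1 hy) with h | h
      · exact Or.inr (Or.inr h.2)
      · exact absurd h.1 (lt_irrefl _)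
  have nbl : ∀ y, s(w l, y) ∈ cycleEdges w ∪ pathEdges p →
      y = w (l + 1) ∨ y = w (l - 1) ∨ y = P (2 * s - 1) := by
    rintro y (hy | hy)
    · rcases eq_or_eq_of_mem_cycleEdges hw hy with h | h
      · exact Or.inl h
      · exact Or.inr (Or.inl h)
    · rw [← hPl] at hy
      rcases path_neighbor hP (by omega) ((hPe _).1 hy) with h | h
      · exact absurd h.1 (lt_irrefl _)
      · exact Or.inr (Or.inr h.2)
  refine ⟨?_, ?_, ?_⟩
  · intro x y h
    obtain ⟨i, hi, h⟩ := (hPe _).1 h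
    rcases Sym2.eq_iff.1 h with ⟨rfl, rfl⟩ | ⟨rfl, rfl⟩
    · exact hpath i hi
    · rw [hX.symm, hpath i hi]
  · intro j
    rw [sub_add_cancel, hX.symm (w (j - 1))]
    by_cases hj : j = 0 ∨ j = l
    · rw [if_pos hj]
      rcases hj with hj | hj
      · have h1 := sum_eq_triple (hne2 0)
          (fun h => hint 1 (by omega) (by omega) ⟨_, h⟩)
          (fun h => hint 1 (by omega) (by omega) ⟨_, h⟩) (fun y hy => nb0 y (hsupp _ _ hy))
        have h2 := hpath 0 (by omega)
        rw [hP0, zero_add] at h2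
        rw [hX.row, h2] at h1
        rw [hj]
        linarith
      · have h1 := sum_eq_triple (hne2 l)
          (fun h => hint (2 * s - 1) (by omega) (by omega) ⟨_, h⟩)
          (fun h => hint (2 * s - 1) (by omega) (by omega) ⟨_, h⟩)
          (fun y hy => nbl y (hsupp _ _ hy))
        have h2 := hpath (2 * s - 1) (by omega)
        rw [Nat.sub_add_cancel (by omega), hPl, hX.symm] at h2
        rw [hX.row, h2] at h1
        rw [hj]
        linarith
    · rw [if_neg hj, ← hX.row (w j), sum_eq_pair (hne2 j)]
      · ring
      · intro y hy
        rcases hsupp _ _ hy with h | h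
        · exact eq_or_eq_of_mem_cycleEdges hw h
        · exact absurd (hwp1 j (hpl h)) hj
  -- The vertex `w 0` lies in both halves, hence so does its reflection. The halves share only `w 0`
  -- and `w l`, and `w 0` is not the centre, hence not fixed.
  · have hr0 : (w 0).rev = w l := by
      have hne : (w 0).rev ≠ w 0 := by
        rw [Ne, rev_eq_self_iff hn, ← hPs, ← hP0]
        intro h
        have := hP _ _ (by omega) (by omega) h
        omega
      have h1 : (w 0).rev ∈ (fun j : ℕ => w (j : ZMod (2 * l))) '' Set.Icc l (2 * l) := by
        rw [← hρ]
        exact ⟨_, ⟨0, ⟨le_rfl, by omega⟩, by simp⟩, rfl⟩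
      have h2 : w 0 ∈ (fun j : ℕ => w (j : ZMod (2 * l))) '' Set.Icc l (2 * l) :=
        ⟨2 * l, ⟨by omega, le_rfl⟩, by simp only [ZMod.natCast_self]⟩
      rw [← hρ] at h2
      obtain ⟨_, ⟨a, ⟨-, ha⟩, rfl⟩, h3⟩ := h2
      obtain ⟨b, ⟨hb1, hb2⟩, h4⟩ := h1
      simp only at h3 h4
      rw [← h3, Fin.rev_rev] at h4
      have h5 := (hcast _ _).1 (hw h4)
      rw [Nat.mod_eq_of_lt (by omega : a < 2 * l)] at h5
      rcases hb2.eq_or_lt with h6 | h6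
      · rw [h6, Nat.mod_self] at h5
        rw [← h5, Nat.cast_zero] at h3
        exact absurd h3 hne
      · rw [Nat.mod_eq_of_lt h6] at h5
        have h7 : a = l := by omega
        rw [h7] at h3
        rw [← h3, Fin.rev_rev]
    -- The reflection of `w 1` is a neighbour of `w l` in the second half, which excludes `w (l -
    -- 1)` and the path.
    have hr1 : (w (0 + 1)).rev = w (l + 1) := by
      have h1 : (w (0 + 1)).rev ∈ (fun j : ℕ => w (j : ZMod (2 * l))) '' Set.Icc l (2 * l) := by
        rw [← hρ]
        exact ⟨_, ⟨1, ⟨by omega, by omega⟩, by simp⟩, rfl⟩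
      obtain ⟨b, ⟨hb1, hb2⟩, h4⟩ := h1
      simp only at h4
      have h2 := hE (w 0) (w (0 + 1)) (Or.inl ⟨0, rfl⟩)
      rw [hr0] at h2
      rcases nbl _ h2 with h | h | h
      · exact h
      · rw [← h4] at h
        have h5 := hw h
        have h6 : (l : ZMod (2 * l)) - 1 = (l - 1 : ℕ) := by
          rw [Nat.cast_sub (by omega), Nat.cast_one]
        rw [h6, hcast, Nat.mod_eq_of_lt (by omega : l - 1 < 2 * l)] at h5
        rcases hb2.eq_or_lt with h6 | h6
        · rw [h6, Nat.mod_self] at h5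
          omega
        · rw [Nat.mod_eq_of_lt h6] at h5
          omega
      · exact absurd ⟨_, h4.trans h⟩ (hint (2 * s - 1) (by omega) (by omega))
    rw [← hX.rev (w 0), hr0, hr1]

theorem mem_extremePoints_of_isCentralType (hn : Odd n) {A : Matrix (Fin n) (Fin n) ℝ}
    (hA : A ∈ OmegaTH n) (h : IsCentralType hn (loopyGraph A)) :
    A ∈ Set.extremePoints ℝ (OmegaTH n) := by
  rw [mem_extremePoints_OmegaTH_iff hA]
  intro X hX hs
  obtain ⟨hA0, hA1⟩ := mem_OmegaTH_iff.1 hA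
  have hrev : ∀ E : Set (Sym2 (Fin n)), (∀ x y, (loopyGraph A).Adj x y ↔ s(x, y) ∈ E) →
      (∀ x y, s(x, y) ∈ E → s(x.rev, y.rev) ∈ E) ∧ (∀ x y, A x y ≠ 0 → s(x, y) ∈ E) := by
    intro E hE
    have hE' : ∀ x y, A x y ≠ 0 ↔ s(x, y) ∈ E := fun x y => by rw [← hE, loopyGraph_adj hA1]
    refine ⟨fun x y hxy => ?_, fun x y => (hE' x y).1⟩
    rw [← hE', hA1.rev, hE']
    exact hxy
  rcases h with ⟨k, w, hk, hw, -, -, hE⟩ |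
    ⟨k, s, w, w', p, hk, hw, hw', hp, hne, h0, hlast, hc, hwp, hwp', hww, hs0, -, hE⟩ |
    ⟨l, s, w, p, hl, hs1, hw, hp, h0, hlast, hc, hwp, hρ, -, hE⟩
  · obtain ⟨-, hE2⟩ := hrev _ hE
    have hz := hX.odd_cycle_eq_zero hk (w := w) fun j y hy =>
      eq_or_eq_of_mem_cycleEdges hw (hE2 _ _ (hs _ _ hy))
    ext x y
    by_contra h
    exact h (eq_zero_of_mem_cycleEdges hX hz (hE2 _ _ (hs _ _ h)))
  · obtain ⟨hE1, hE2⟩ := hrev _ hE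
    exact eq_zero_of_typeB hn hX hk hw hw' hp hne h0 hlast hc hwp hwp' hww hs0 hE1
      fun x y hxy => hE2 x y (hs x y hxy)
  · obtain ⟨hE1, hE2⟩ := hrev _ hE
    obtain ⟨-, hA2, hA3⟩ := typeC_entries hn hA1 hl hs1 hw hp h0 hlast hc hwp hρ hE1 hE2
    obtain ⟨hX1, hX2, hX3⟩ := typeC_entries hn hX hl hs1 hw hp h0 hlast hc hwp hρ hE1
      fun x y hxy => hE2 x y (hs x y hxy)
    have hcast : ∀ a b : ℕ, (a : ZMod (2 * l)) = b ↔ a % (2 * l) = b % (2 * l) :=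
      fun a b => ZMod.natCast_eq_natCast_iff' a b _
    -- Deviations from `1 / 2` alternate along the first half. For even `l` the two cycle entries of
    -- `A` at `w l` would thus add up to `1`, whereas the path leaves only `1 / 2`.
    have hodd : Odd l := by
      rw [← Nat.not_even_iff_odd]
      intro hev
      have key : ∀ m : ℕ, m < l → A (w m) (w (m + 1)) =
          1 / 2 + (-1) ^ m * (A (w 0) (w (0 + 1)) - 1 / 2) := by
        intro m
        induction m with
        | zero => intro _; simp
        | succ m ih =>
          intro hm
          have h1 := hA2 ((m + 1 : ℕ) : ZMod (2 * l))
          have hne : ¬ (((m + 1 : ℕ) : ZMod (2 * l)) = 0 ∨ ((m + 1 : ℕ) : ZMod (2 * l)) = l) := by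
            rw [← Nat.cast_zero, hcast, hcast, Nat.mod_eq_of_lt (by omega : m + 1 < 2 * l),
              Nat.mod_eq_of_lt (by omega : l < 2 * l), Nat.zero_mod]
            omega
          have h2 : ((m + 1 : ℕ) : ZMod (2 * l)) - 1 = (m : ℕ) := by push_cast; ring
          rw [if_neg hne, h2, ih (by omega)] at h1
          rw [pow_succ]
          linarith
      have h1 := key (l - 1) (by omega)
      have h2 := hA2 l
      have h3 : (l : ZMod (2 * l)) - 1 = (l - 1 : ℕ) := by
        rw [Nat.cast_sub (by omega), Nat.cast_one]
      have h4 : Odd (l - 1) := by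
        obtain ⟨m, hm⟩ := hev
        exact ⟨m - 1, by omega⟩
      rw [if_pos (Or.inr rfl), h3, h1, hA3, h4.neg_one_pow] at h2
      linarith
    have : NeZero (2 * l) := ⟨by omega⟩
    have hstep : ∀ j ≠ (0 : ZMod (2 * l)),
        X (w (j - 1)) (w (j - 1 + 1)) + X (w j) (w (j + 1)) = 0 := fun j _ => by
      rw [hX2 j]
      simp
    -- As `l` is odd, alternation gives the entry at `w l` as minus the entry at `w 0`; `hX3` says
    -- that they are equal.
    have h1 := alternating_apply (x := fun j => X (w j) (w (j + 1))) hstep l (by omega)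
    rw [hX3, hodd.neg_one_pow] at h1
    have hz := alternating_eq_zero (x := fun j => X (w j) (w (j + 1))) hstep
      (by linarith)
    ext x y
    by_contra h
    rcases hE2 _ _ (hs _ _ h) with h2 | h2
    · exact h (eq_zero_of_mem_cycleEdges hX hz h2)
    · exact h (by simpa using hX1 x y h2)

end Converse

/-! ### Linear dependence of edge orbits -/

section Realizes

variable {n : ℕ}

/-- The pairs `x, y` and `a, b` are equal as unordered pairs, up to the reflection. -/
def SameOrbit (x y a b : Fin n) : Prop := s(x, y) = s(a, b) ∨ s(x, y) = s(a.rev, b.rev)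

lemma SameOrbit.swap {x y a b : Fin n} (h : SameOrbit x y a b) : SameOrbit y x a b := by
  rcases h with h | h
  · exact Or.inl (Sym2.eq_swap.trans h)
  · exact Or.inr (Sym2.eq_swap.trans h)

lemma SameOrbit.rev {x y a b : Fin n} (h : SameOrbit x y a b) : SameOrbit x.rev y.rev a b := by
  rcases h with h | h
  · exact Or.inr (congrArg (Sym2.map Fin.rev) h)
  · left
    have := congrArg (Sym2.map Fin.rev) h
    simpa using this

/-- The sum of the indicator vectors of `x` and its reflection. -/
def orbitVector (x : Fin n) : Fin n → ℝ := Pi.single x 1 + Pi.single x.rev 1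

lemma orbitVector_rev (x : Fin n) : orbitVector x.rev = orbitVector x := by
  rw [orbitVector, orbitVector, Fin.rev_rev, add_comm]

/-- The vector `d` is the vector of row sums of a symmetric and Hankel symmetric matrix supported
in the relation `R`. -/
def Realizes (R : Fin n → Fin n → Prop) (d : Fin n → ℝ) : Prop :=
  ∃ X : Matrix (Fin n) (Fin n) ℝ, (∀ i j, X i j = X j i) ∧ (∀ i j, X i.rev j.rev = X i j) ∧
    (∀ i, ∑ j, X i j = d i) ∧ ∀ i j, X i j ≠ 0 → R i j

lemma Realizes.mono {R R' : Fin n → Fin n → Prop} {d : Fin n → ℝ} (h : Realizes R d)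
    (hR : ∀ x y, R x y → R' x y) : Realizes R' d := by
  obtain ⟨X, h1, h2, h3, h4⟩ := h
  exact ⟨X, h1, h2, h3, fun i j hij => hR _ _ (h4 i j hij)⟩

lemma Realizes.linear {R : Fin n → Fin n → Prop} {d d' : Fin n → ℝ} (h : Realizes R d)
    (h' : Realizes R d') (a b : ℝ) : Realizes R (a • d + b • d') := by
  obtain ⟨X, h1, h2, h3, h4⟩ := h
  obtain ⟨Y, g1, g2, g3, g4⟩ := h'
  refine ⟨a • X + b • Y, fun i j => by simp [h1 i j, g1 i j], fun i j => by simp [h2 i j, g2 i j],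
    fun i => by simp [Finset.sum_add_distrib, ← Finset.mul_sum, h3 i, g3 i], fun i j hij => ?_⟩
  by_contra hR
  have e1 : X i j = 0 := by_contra fun h => hR (h4 i j h)
  have e2 : Y i j = 0 := by_contra fun h => hR (g4 i j h)
  simp [e1, e2] at hij

lemma realizes_zero (R : Fin n → Fin n → Prop) : Realizes R 0 :=
  ⟨0, by simp, by simp, by simp, by simp⟩

/-- The sum of the matrix units of the orbit of `(x, y)`. -/
def orbitMatrix (x y : Fin n) : Matrix (Fin n) (Fin n) ℝ :=
  Matrix.of fun i j => (if i = x ∧ j = y then 1 else 0) + (if i = y ∧ j = x then 1 else 0) +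
    (if i.rev = x ∧ j.rev = y then 1 else 0) + (if i.rev = y ∧ j.rev = x then 1 else 0)

lemma sum_ite_and (P : Prop) [Decidable P] (y : Fin n) :
    ∑ j : Fin n, (if P ∧ j = y then (1 : ℝ) else 0) = if P then 1 else 0 := by
  by_cases h : P <;> simp [h]

/-- Coinciding matrix units are counted with multiplicity, so loops, the centre and self-reflected
edges need no separate formula. -/
lemma sum_orbitMatrix (x y i : Fin n) :
    ∑ j, orbitMatrix x y i j = (orbitVector x + orbitVector y) i := by
  simp only [orbitMatrix, Matrix.of_apply, Finset.sum_add_distrib, sum_ite_and,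
    orbitVector, Pi.add_apply, Pi.single_apply, Fin.rev_eq_iff]
  ring

lemma orbitMatrix_symm (x y i j : Fin n) : orbitMatrix x y i j = orbitMatrix x y j i := by
  simp only [orbitMatrix, Matrix.of_apply, and_comm]
  ring

lemma orbitMatrix_rev (x y i j : Fin n) : orbitMatrix x y i.rev j.rev = orbitMatrix x y i j := by
  simp only [orbitMatrix, Matrix.of_apply, Fin.rev_rev]
  ring

lemma sameOrbit_of_orbitMatrix_ne_zero {x y i j : Fin n} (h : orbitMatrix x y i j ≠ 0) :
    SameOrbit i j x y := by
  by_contra hn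
  apply h
  have h1 : ¬ (i = x ∧ j = y) := fun h => hn (Or.inl (by rw [h.1, h.2]))
  have h2 : ¬ (i = y ∧ j = x) := fun h => hn (Or.inl (by rw [h.1, h.2, Sym2.eq_swap]))
  have h3 : ¬ (i.rev = x ∧ j.rev = y) := fun h => hn (Or.inr (by rw [← h.1, ← h.2]; simp))
  have h4 : ¬ (i.rev = y ∧ j.rev = x) := fun h =>
    hn (Or.inr (by rw [← h.1, ← h.2, Sym2.eq_swap]; simp))
  simp only [orbitMatrix, Matrix.of_apply, if_neg h1, if_neg h2, if_neg h3, if_neg h4, add_zero]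

lemma one_le_orbitMatrix (x y : Fin n) : 1 ≤ orbitMatrix x y x y := by
  simp only [orbitMatrix, Matrix.of_apply, and_self, if_true]
  have h : ∀ (P : Prop) [Decidable P], (0 : ℝ) ≤ if P then 1 else 0 := fun P _ => by
    split_ifs <;> norm_num
  have h1 := h (x = y ∧ y = x)
  have h2 := h (x.rev = x ∧ y.rev = y)
  have h3 := h (x.rev = y ∧ y.rev = x)
  linarith

lemma realizes_edge (x y : Fin n) :
    Realizes (fun i j => SameOrbit i j x y) (orbitVector x + orbitVector y) :=
  ⟨orbitMatrix x y, orbitMatrix_symm x y, orbitMatrix_rev x y, sum_orbitMatrix x y,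
    fun _ _ => sameOrbit_of_orbitMatrix_ne_zero⟩

/-- In an extreme matrix, no edge is dependent on edges outside its orbit. -/
lemma not_realizes_edge {A : Matrix (Fin n) (Fin n) ℝ} (hA : A ∈ Set.extremePoints ℝ (OmegaTH n))
    {R : Fin n → Fin n → Prop} (hR : ∀ i j, R i j → A i j ≠ 0) {x y : Fin n} (hxy : A x y ≠ 0)
    (hn : ¬ R x y) : ¬ Realizes R (orbitVector x + orbitVector y) := by
  rintro ⟨X, h1, h2, h3, h4⟩
  obtain ⟨-, hA1⟩ := mem_OmegaTH_iff.1 hA.1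
  -- This difference is an admissible perturbation; its entry at `(x, y)` is at most `-1`, since `X`
  -- vanishes there.
  have hX : X - orbitMatrix x y = 0 := by
    refine (mem_extremePoints_OmegaTH_iff hA.1).1 hA _ ⟨fun i j => ?_, fun i j => ?_, fun i => ?_⟩
      fun i j hij hz => hij ?_
    · simp only [Matrix.sub_apply]
      rw [h1, orbitMatrix_symm]
    · simp only [Matrix.sub_apply]
      rw [h2, orbitMatrix_rev]
    · simp only [Matrix.sub_apply, Finset.sum_sub_distrib, h3, sum_orbitMatrix, sub_self]
    · have e1 : X i j = 0 := by_contra fun h => hR _ _ (h4 i j h) hz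
      have e2 : orbitMatrix x y i j = 0 := by
        by_contra h
        rcases sameOrbit_of_orbitMatrix_ne_zero h with h | h
        · rcases Sym2.eq_iff.1 h with ⟨rfl, rfl⟩ | ⟨rfl, rfl⟩
          · exact hxy hz
          · exact hxy (by rw [hA1.symm, hz])
        · rcases Sym2.eq_iff.1 h with ⟨rfl, rfl⟩ | ⟨rfl, rfl⟩
          · exact hxy (by rw [← hA1.rev, hz])
          · exact hxy (by rw [← hA1.rev, hA1.symm, hz])
      simp [e1, e2]
  have h5 : X x y = 0 := by_contra fun h => hn (h4 x y h)
  have h6 := congrFun (congrFun hX x) y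
  have h7 := one_le_orbitMatrix x y
  simp only [Matrix.sub_apply, Matrix.zero_apply, h5] at h6
  linarith

/-- The edges of a walk with indices in `[a, b)`, up to the reflection. -/
def WalkEdge (v : ℕ → Fin n) (a b : ℕ) (x y : Fin n) : Prop :=
  ∃ j, a ≤ j ∧ j < b ∧ SameOrbit x y (v j) (v (j + 1))

lemma WalkEdge.mono {v : ℕ → Fin n} {a b a' b' : ℕ} {x y : Fin n} (h : WalkEdge v a b x y)
    (ha : a' ≤ a) (hb : b ≤ b') : WalkEdge v a' b' x y := by
  obtain ⟨j, h1, h2, h3⟩ := h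
  exact ⟨j, ha.trans h1, h2.trans_le hb, h3⟩

/-- Give the edges of the walk alternating signs; the sum telescopes. -/
lemma realizes_walk (v : ℕ → Fin n) (a d : ℕ) :
    Realizes (WalkEdge v a (a + d)) (orbitVector (v a) - (-1 : ℝ) ^ d • orbitVector (v (a + d))) := by
  induction d with
  | zero => simpa using realizes_zero _
  | succ d ih =>
    have h1 := ih.mono (R' := WalkEdge v a (a + d + 1))
      fun x y h => h.mono le_rfl (Nat.le_succ (a + d))
    have h2 := (realizes_edge (v (a + d)) (v (a + d + 1))).mono (R' := WalkEdge v a (a + d + 1))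
      fun x y h => ⟨a + d, by omega, by omega, h⟩
    have h3 := h1.linear h2 1 ((-1) ^ d)
    rw [← add_assoc, pow_succ]
    convert h3 using 1
    module

end Realizes

/-! ### The component of the centre modulo the reflection -/

section Component

variable {n : ℕ}

/-- Reachability in the loopy graph, in terms of the matrix. -/
def EntryReachable (A : Matrix (Fin n) (Fin n) ℝ) : Fin n → Fin n → Prop :=
  Relation.ReflTransGen fun x y => A x y ≠ 0

lemma joined_rev (hn : Odd n) {A : Matrix (Fin n) (Fin n) ℝ} {r : ℝ} (hA : IsTH r A) {x : Fin n}
    (h : EntryReachable A (centralVertex hn) x) : EntryReachable A (centralVertex hn) x.rev := by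
  induction h with
  | refl => rw [rev_centralVertex hn]; exact Relation.ReflTransGen.refl
  | tail _ h ih => exact ih.tail (by rwa [hA.rev])

lemma exists_entry_ne_zero {A : Matrix (Fin n) (Fin n) ℝ} (hA : IsTH 1 A) (x : Fin n) :
    ∃ y, A x y ≠ 0 := by
  by_contra! h
  have := hA.row x
  simp [h] at this

/-- A vertex other than the centre in the component of the centre has at least two neighbours. -/
lemma exists_other_neighbor (hn : Odd n) {A : Matrix (Fin n) (Fin n) ℝ} (hA0 : ∀ i j, 0 ≤ A i j)
    (hA : IsTH 1 A) {x : Fin n} (hx : x ≠ centralVertex hn) (hj : EntryReachable A (centralVertex hn) x)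
    (u : Fin n) : ∃ y, A x y ≠ 0 ∧ y ≠ u := by
  by_contra! h
  have h1 : A x u = 1 := by
    rw [← hA.row x, Finset.sum_eq_single u (fun y _ hy => by_contra fun h0 => hy (h y h0)) (by simp)]
  have h2 : ∀ y, A u y ≠ 0 → y = x := by
    intro y hy
    by_contra hne
    have h3 : A u x + A u y ≤ 1 := by
      rw [← hA.row u, ← Finset.sum_pair (Ne.symm hne)]
      exact Finset.sum_le_sum_of_subset_of_nonneg (Finset.subset_univ _) fun _ _ _ => hA0 _ _
    rw [hA.symm u x, h1] at h3
    exact hy (le_antisymm (by linarith) (hA0 _ _))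
  -- The set `{x, u}` is closed under adjacency, so it contains the centre.
  have h4 : ∀ y, EntryReachable A (centralVertex hn) y → (y = x ∨ y = u) →
      centralVertex hn = x ∨ centralVertex hn = u := by
    intro y hy
    induction hy with
    | refl => exact id
    | @tail b c _ hbc ih =>
      rw [hA.symm] at hbc
      rintro (rfl | rfl)
      · exact ih (Or.inr (h _ hbc))
      · exact ih (Or.inl (h2 _ hbc))
  rcases h4 x hj (Or.inl rfl) with h5 | h5
  · exact hx h5.symm
  -- Now `u` is the centre and `x` its only neighbour; the reflection of `x` is a neighbour too, so
  -- `x` is fixed.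
  · have h6 : A u x.rev ≠ 0 := by
      rw [← h5, ← rev_centralVertex hn, hA.rev, hA.symm, h5, h1]
      norm_num
    exact hx ((rev_eq_self_iff hn x).1 (h2 _ h6))

/-- Turning back is allowed only at the centre, which may have a single neighbour. -/
lemma exists_walk (hn : Odd n) {A : Matrix (Fin n) (Fin n) ℝ} (hA0 : ∀ i j, 0 ≤ A i j)
    (hA : IsTH 1 A) : ∃ v : ℕ → Fin n, v 0 = centralVertex hn ∧ (∀ j, A (v j) (v (j + 1)) ≠ 0) ∧
      ∀ j, v (j + 1) ≠ centralVertex hn → v (j + 2) ≠ v j := by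
  have key : ∀ a b : Fin n, ∃ y, EntryReachable A (centralVertex hn) b →
      A b y ≠ 0 ∧ (b ≠ centralVertex hn → y ≠ a) := by
    intro a b
    by_cases hj : EntryReachable A (centralVertex hn) b
    · by_cases hb : b = centralVertex hn
      · obtain ⟨y, hy⟩ := exists_entry_ne_zero hA b
        exact ⟨y, fun _ => ⟨hy, fun h => absurd hb h⟩⟩
      · obtain ⟨y, hy, hya⟩ := exists_other_neighbor hn hA0 hA hb hj a
        exact ⟨y, fun _ => ⟨hy, fun _ => hya⟩⟩
    · exact ⟨a, fun h => absurd h hj⟩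
  choose f hf using key
  -- The state is the pair of the current and the next vertex; the next step must avoid the first of
  -- them.
  let q : ℕ → Fin n × Fin n := fun j =>
    Nat.rec (centralVertex hn, f (centralVertex hn) (centralVertex hn))
      (fun _ p => (p.2, f p.1 p.2)) j
  have hq : ∀ j, q (j + 1) = ((q j).2, f (q j).1 (q j).2) := fun j => rfl
  have hinv : ∀ j, EntryReachable A (centralVertex hn) (q j).1 ∧ A (q j).1 (q j).2 ≠ 0 := by
    intro j
    induction j with
    | zero =>
      exact ⟨Relation.ReflTransGen.refl, (hf _ _ Relation.ReflTransGen.refl).1⟩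
    | succ j ih =>
      rw [hq]
      exact ⟨ih.1.tail ih.2, (hf _ _ (ih.1.tail ih.2)).1⟩
  refine ⟨fun j => (q j).1, rfl, fun j => (hinv j).2, fun j hj => ?_⟩
  exact (hf _ _ ((hinv j).1.tail (hinv j).2)).2 hj

/-- `v 0, …, v t` is a walk whose image modulo the reflection is a path that starts at the centre,
followed by a cycle that starts at `v i`. -/
structure IsLollipop (hn : Odd n) (A : Matrix (Fin n) (Fin n) ℝ) (v : ℕ → Fin n) (i t : ℕ) :
    Prop where
  lt : i < t
  zero : v 0 = centralVertex hn
  adj : ∀ j < t, A (v j) (v (j + 1)) ≠ 0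
  inj : ∀ a b, a < b → b < t → v b ≠ v a ∧ v b ≠ (v a).rev
  close : v t = v i ∨ v t = (v i).rev
  ne : t = i + 2 → v t ≠ v i

lemma exists_isLollipop (hn : Odd n) {A : Matrix (Fin n) (Fin n) ℝ} (hA0 : ∀ i j, 0 ≤ A i j)
    (hA : IsTH 1 A) : ∃ v i t, IsLollipop hn A v i t := by
  obtain ⟨v, h0, hadj, hback⟩ := exists_walk hn hA0 hA
  have hex : ∃ t, ∃ i < t, v t = v i ∨ v t = (v i).rev := by
    obtain ⟨a, b, hab, h⟩ := Finite.exists_ne_map_eq_of_infinite v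
    rcases lt_or_gt_of_ne hab with hlt | hlt
    · exact ⟨b, a, hlt, Or.inl h.symm⟩
    · exact ⟨a, b, hlt, Or.inl h⟩
  classical
  -- The walk is cut at the first time it meets an orbit again.
  obtain ⟨i, hi, hclose⟩ := Nat.find_spec hex
  have hinj : ∀ a b, a < b → b < Nat.find hex → v b ≠ v a ∧ v b ≠ (v a).rev := by
    intro a b hab hb
    have := Nat.find_min hex hb
    push Not at this
    exact this a hab
  refine ⟨v, i, Nat.find hex, hi, h0, fun j _ => hadj j, hinj, hclose, fun ht => ?_⟩
  rw [ht]
  refine hback i fun hc => ?_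
  exact (hinj 0 (i + 1) (by omega) (by omega)).1 (by rw [hc, h0])

namespace IsLollipop

variable {hn : Odd n} {A : Matrix (Fin n) (Fin n) ℝ} {v : ℕ → Fin n} {i t : ℕ}

lemma eq_of_orbit (h : IsLollipop hn A v i t) {a b : ℕ} (ha : a < t) (hb : b < t)
    (hab : v a = v b ∨ v a = (v b).rev) : a = b := by
  rcases lt_trichotomy a b with h1 | h1 | h1
  · rcases hab with h2 | h2
    · exact absurd h2.symm (h.inj a b h1 hb).1
    · exact absurd (by rw [h2, Fin.rev_rev]) (h.inj a b h1 hb).2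
  · exact h1
  · rcases hab with h2 | h2
    · exact absurd h2 (h.inj b a h1 ha).1
    · exact absurd h2 (h.inj b a h1 ha).2

lemma eq_zero (h : IsLollipop hn A v i t) {a : ℕ} (ha : a < t) (hc : v a = centralVertex hn) :
    a = 0 :=
  h.eq_of_orbit ha (by omega) (Or.inl (by rw [hc, h.zero]))

/-- A repeated orbit could only be the last edge retracing the one before it. Then either the walk
turns back, against `ne`, or its vertex `v b` with `b > 0` is fixed by the reflection and so is the
centre. -/
lemma not_sameOrbit (h : IsLollipop hn A v i t) {a b : ℕ} (hab : a < b) (hb : b < t) :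
    ¬ SameOrbit (v a) (v (a + 1)) (v b) (v (b + 1)) := by
  intro hs
  have key : (v a = v (b + 1) ∧ v (a + 1) = v b) ∨
      (v a = (v (b + 1)).rev ∧ v (a + 1) = (v b).rev) := by
    rcases hs with hs | hs
    · rcases Sym2.eq_iff.1 hs with h1 | h1
      · exact absurd h1.1.symm (h.inj a b hab hb).1
      · exact Or.inl h1
    · rcases Sym2.eq_iff.1 hs with h1 | h1
      · exact absurd (by rw [h1.1, Fin.rev_rev]) (h.inj a b hab hb).2
      · exact Or.inr h1
  have e1 : a + 1 = b := h.eq_of_orbit (by omega) hb (key.imp And.right And.right)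
  have e2 : b + 1 = t := by
    by_contra hne
    have := h.eq_of_orbit (a := a) (b := b + 1) (by omega) (by omega)
      (key.imp And.left And.left)
    omega
  have e3 : a = i := by
    refine h.eq_of_orbit (by omega) h.lt ?_
    rw [e2] at key
    rcases key with k | k <;> rcases h.close with c | c
    · left; rw [k.1, c]
    · right; rw [k.1, c]
    · right; rw [k.1, c]
    · left; rw [k.1, c, Fin.rev_rev]
  rcases key with k | k
  · refine h.ne (by omega) ?_
    rw [← e2, ← k.1, e3]
  · have h1 : v b = (v b).rev := by rw [← k.2, e1]
    have := h.eq_zero hb ((rev_eq_self_iff hn _).1 h1.symm)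
    omega

lemma orbitVector_close (h : IsLollipop hn A v i t) : orbitVector (v t) = orbitVector (v i) := by
  rcases h.close with c | c
  · rw [c]
  · rw [c, orbitVector_rev]

lemma ne_zero_of_walkEdge (h : IsLollipop hn A v i t) {r : ℝ} (hA : IsTH r A) {x y : Fin n}
    (hxy : WalkEdge v 0 t x y) : A x y ≠ 0 := by
  obtain ⟨j, -, hj, hs⟩ := hxy
  have h1 := h.adj j hj
  rcases hs with hs | hs
  · rcases Sym2.eq_iff.1 hs with ⟨rfl, rfl⟩ | ⟨rfl, rfl⟩
    · exact h1
    · rwa [hA.symm]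
  · rcases Sym2.eq_iff.1 hs with ⟨rfl, rfl⟩ | ⟨rfl, rfl⟩
    · rwa [hA.rev]
    · rwa [hA.rev, hA.symm]

/-- If the cycle were even, its first edge would be the alternating sum of the remaining ones. -/
lemma odd (h : IsLollipop hn A v i t) (hA : A ∈ Set.extremePoints ℝ (OmegaTH n)) :
    Odd (t - i) := by
  obtain ⟨-, hA1⟩ := mem_OmegaTH_iff.1 hA.1
  rw [← Nat.not_even_iff_odd]
  intro hev
  have hlt := h.lt
  have h1 := (realizes_walk v (i + 1) (t - i - 1)).mono (R' := WalkEdge v (i + 1) t)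
    fun x y hxy => hxy.mono le_rfl (by omega)
  have h2 : Odd (t - i - 1) := by
    obtain ⟨m, hm⟩ := hev
    exact ⟨m - 1, by omega⟩
  rw [h2.neg_one_pow, show i + 1 + (t - i - 1) = t by omega, h.orbitVector_close, neg_one_smul,
    sub_neg_eq_add, add_comm (orbitVector (v (i + 1)))] at h1
  refine not_realizes_edge hA (R := WalkEdge v (i + 1) t)
    (fun x y hxy => h.ne_zero_of_walkEdge hA1 (hxy.mono (Nat.zero_le _) le_rfl))
    (h.adj i hlt) ?_ h1
  rintro ⟨j, hj1, hj2, hs⟩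
  exact h.not_sameOrbit (by omega) hj2 hs

/-- Going once around the odd cycle gives twice the vector of `v i`; a walk transfers it to every
other vertex. -/
lemma realizes_vertex (h : IsLollipop hn A v i t) (hodd : Odd (t - i)) {j : ℕ} (hj : j < t) :
    Realizes (WalkEdge v 0 t) (orbitVector (v j)) := by
  have hlt := h.lt
  have hi : Realizes (WalkEdge v 0 t) (orbitVector (v i)) := by
    have h1 := (realizes_walk v i (t - i)).mono (R' := WalkEdge v 0 t)
      fun x y h => h.mono (Nat.zero_le _) (by omega)
    rw [hodd.neg_one_pow, show i + (t - i) = t by omega, h.orbitVector_close] at h1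
    have h2 := h1.linear h1 (1 / 4) (1 / 4)
    convert h2 using 1
    module
  rcases le_total j i with hji | hji
  · obtain ⟨d, rfl⟩ := Nat.exists_eq_add_of_le hji
    have h1 := ((realizes_walk v j d).mono (R' := WalkEdge v 0 t)
      fun x y h => h.mono (Nat.zero_le _) (by omega)).linear hi 1 ((-1) ^ d)
    convert h1 using 1
    module
  · obtain ⟨d, rfl⟩ := Nat.exists_eq_add_of_le hji
    have h1 := ((realizes_walk v i d).mono (R' := WalkEdge v 0 t)
      fun x y h => h.mono (Nat.zero_le _) (by omega)).linear hi (-(-1) ^ d) ((-1) ^ d)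
    convert h1 using 1
    have h2 : ((-1 : ℝ) ^ d) * (-1) ^ d = 1 := by rw [← mul_pow]; simp
    rw [smul_sub, smul_smul, neg_mul, h2]
    module

lemma joined (h : IsLollipop hn A v i t) {j : ℕ} (hj : j ≤ t) :
    EntryReachable A (centralVertex hn) (v j) := by
  induction j with
  | zero => rw [h.zero]; exact Relation.ReflTransGen.refl
  | succ j ih => exact (ih (by omega)).tail (h.adj j (by omega))

/-- The vertices of a lollipop and their reflections. -/
def support (v : ℕ → Fin n) (t : ℕ) : Set (Fin n) := {x | ∃ j < t, x = v j ∨ x = (v j).rev}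

lemma realizes_of_mem_support (h : IsLollipop hn A v i t) (hodd : Odd (t - i)) {x : Fin n}
    (hx : x ∈ support v t) : Realizes (WalkEdge v 0 t) (orbitVector x) := by
  obtain ⟨j, hj, rfl | rfl⟩ := hx
  · exact h.realizes_vertex hodd hj
  · rw [orbitVector_rev]
    exact h.realizes_vertex hodd hj

lemma close_mem_support (h : IsLollipop hn A v i t) : v t ∈ support v t := ⟨i, h.lt, h.close⟩

lemma rev_mem_support {x : Fin n} (hx : x ∈ support v t) : x.rev ∈ support v t := by
  obtain ⟨j, hj, rfl | rfl⟩ := hx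
  · exact ⟨j, hj, Or.inr rfl⟩
  · exact ⟨j, hj, Or.inl (by rw [Fin.rev_rev])⟩

lemma mem_support_of_le (h : IsLollipop hn A v i t) {j : ℕ} (hj : j ≤ t) : v j ∈ support v t := by
  rcases hj.eq_or_lt with rfl | hj
  · exact h.close_mem_support
  · exact ⟨j, hj, Or.inl rfl⟩

lemma mem_support_of_walkEdge (h : IsLollipop hn A v i t) {x y : Fin n}
    (hxy : WalkEdge v 0 t x y) : x ∈ support v t := by
  obtain ⟨j, -, hj, hs⟩ := hxy
  have h1 := h.mem_support_of_le hj.le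
  have h2 := h.mem_support_of_le (j := j + 1) hj
  rcases hs with hs | hs
  · rcases Sym2.eq_iff.1 hs with ⟨rfl, rfl⟩ | ⟨rfl, rfl⟩
    · exact h1
    · exact h2
  · rcases Sym2.eq_iff.1 hs with ⟨rfl, rfl⟩ | ⟨rfl, rfl⟩
    · exact rev_mem_support h1
    · exact rev_mem_support h2

/-- There are no chords: the orbit vectors of both ends are already realized by the walk, so a
further edge would be dependent. -/
lemma ne_zero_iff_walkEdge (h : IsLollipop hn A v i t)
    (hA : A ∈ Set.extremePoints ℝ (OmegaTH n)) {x y : Fin n} (hx : x ∈ support v t)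
    (hy : y ∈ support v t) : A x y ≠ 0 ↔ WalkEdge v 0 t x y := by
  obtain ⟨-, hA1⟩ := mem_OmegaTH_iff.1 hA.1
  refine ⟨fun hxy => ?_, h.ne_zero_of_walkEdge hA1⟩
  by_contra hns
  refine not_realizes_edge hA (fun x y => h.ne_zero_of_walkEdge hA1) hxy hns ?_
  have := (h.realizes_of_mem_support (h.odd hA) hx).linear
    (h.realizes_of_mem_support (h.odd hA) hy) 1 1
  simpa using this

/-- Otherwise the lollipop can be enlarged one vertex orbit at a time, keeping all orbit vectors
realized, until a single orbit is missing. Its vertex `y` is not a leaf, so it has a second edge,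
which is dependent on the others. -/
lemma joined_iff_mem_support (h : IsLollipop hn A v i t)
    (hA : A ∈ Set.extremePoints ℝ (OmegaTH n)) {x : Fin n} :
    EntryReachable A (centralVertex hn) x ↔ x ∈ support v t := by
  obtain ⟨hA0, hA1⟩ := mem_OmegaTH_iff.1 hA.1
  have hsub : ∀ x ∈ support v t, EntryReachable A (centralVertex hn) x := by
    rintro x ⟨j, hj, rfl | rfl⟩
    · exact h.joined hj.le
    · exact joined_rev hn hA1 (h.joined hj.le)
  refine ⟨fun hx => ?_, hsub x⟩
  by_contra hxs
  -- Only sets that miss part of the component are admitted, so a maximal one is a single vertex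
  -- orbit short of it.
  let F : Set (Set (Fin n)) := {W | support v t ⊆ W ∧ (∀ x ∈ W, EntryReachable A (centralVertex hn) x) ∧
    (∀ x ∈ W, x.rev ∈ W) ∧ (∃ x, EntryReachable A (centralVertex hn) x ∧ x ∉ W) ∧
    ∀ x ∈ W, Realizes (fun i j => i ∈ W ∧ j ∈ W ∧ A i j ≠ 0) (orbitVector x)}
  have hF : support v t ∈ F := by
    refine ⟨subset_rfl, hsub, fun x => rev_mem_support, ⟨x, hx, hxs⟩, fun x hx => ?_⟩
    refine (h.realizes_of_mem_support (h.odd hA) hx).mono fun a b hab => ?_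
    obtain ⟨j, hj1, hj2, hs⟩ := hab
    exact ⟨h.mem_support_of_walkEdge ⟨j, hj1, hj2, hs⟩,
      h.mem_support_of_walkEdge ⟨j, hj1, hj2, hs.swap⟩,
      h.ne_zero_of_walkEdge hA1 ⟨j, hj1, hj2, hs⟩⟩
  obtain ⟨W, hWF, hWmax⟩ := (Set.toFinite F).exists_maximal ⟨_, hF⟩
  obtain ⟨hW1, hW2, hW3, ⟨z, hz, hzW⟩, hW5⟩ := hWF
  have hcW : centralVertex hn ∈ W := hW1 ⟨0, by have := h.lt; omega, Or.inl h.zero.symm⟩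
  obtain ⟨x, y, hxW, hyW, hxy⟩ : ∃ x y, x ∈ W ∧ y ∉ W ∧ A x y ≠ 0 := by
    by_contra! hcon
    apply hzW
    clear hzW
    induction hz with
    | refl => exact hcW
    | tail _ hbc ih => exact by_contra fun hc => hbc (hcon _ _ ih hc)
  have hyJ : EntryReachable A (centralVertex hn) y := (hW2 x hxW).tail hxy
  have hyc : y ≠ centralVertex hn := fun h => hyW (h ▸ hcW)
  have hyx : y ≠ x.rev := fun h => hyW (h ▸ hW3 x hxW)
  have hyr : y.rev ∉ W := fun h => hyW (by simpa using hW3 _ h)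
  have hyy : y ≠ y.rev := fun h => hyc ((rev_eq_self_iff hn y).1 h.symm)
  let R : Fin n → Fin n → Prop := fun i j => (i ∈ W ∧ j ∈ W ∧ A i j ≠ 0) ∨ SameOrbit i j x y
  have hRW : ∀ u ∈ W, Realizes R (orbitVector u) := fun u hu => (hW5 u hu).mono fun _ _ => Or.inl
  have hRy : Realizes R (orbitVector y) := by
    have := ((realizes_edge x y).mono (R' := R) fun _ _ => Or.inr).linear (hRW x hxW) 1 (-1)
    convert this using 1
    module
  have hRA : ∀ i j, R i j → A i j ≠ 0 := by
    rintro i j (hij | hs | hs)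
    · exact hij.2.2
    · rcases Sym2.eq_iff.1 hs with ⟨rfl, rfl⟩ | ⟨rfl, rfl⟩
      · exact hxy
      · rwa [hA1.symm]
    · rcases Sym2.eq_iff.1 hs with ⟨rfl, rfl⟩ | ⟨rfl, rfl⟩
      · rwa [hA1.rev]
      · rwa [hA1.rev, hA1.symm]
  have hRV : ∀ u ∈ W ∪ {y, y.rev}, Realizes R (orbitVector u) := by
    rintro u (hu | rfl | rfl)
    · exact hRW u hu
    · exact hRy
    · rw [orbitVector_rev]
      exact hRy
  have hRmem : ∀ i j, R i j → i ∈ W ∪ {y, y.rev} ∧ j ∈ W ∪ {y, y.rev} := by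
    rintro i j (hij | hs | hs)
    · exact ⟨Or.inl hij.1, Or.inl hij.2.1⟩
    · rcases Sym2.eq_iff.1 hs with ⟨rfl, rfl⟩ | ⟨rfl, rfl⟩
      · exact ⟨Or.inl hxW, Or.inr (Or.inl rfl)⟩
      · exact ⟨Or.inr (Or.inl rfl), Or.inl hxW⟩
    · rcases Sym2.eq_iff.1 hs with ⟨rfl, rfl⟩ | ⟨rfl, rfl⟩
      · exact ⟨Or.inl (hW3 _ hxW), Or.inr (Or.inr rfl)⟩
      · exact ⟨Or.inr (Or.inr rfl), Or.inl (hW3 _ hxW)⟩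
  have hall : ∀ u, EntryReachable A (centralVertex hn) u → u ∈ W ∪ {y, y.rev} := by
    by_contra! hcon
    refine hyW (hWmax (y := W ∪ {y, y.rev}) ⟨hW1.trans Set.subset_union_left, ?_, ?_, hcon, ?_⟩
      Set.subset_union_left (Or.inr (Or.inl rfl)))
    · rintro u (hu | rfl | rfl)
      · exact hW2 u hu
      · exact hyJ
      · exact joined_rev hn hA1 hyJ
    · rintro u (hu | rfl | rfl)
      · exact Or.inl (hW3 u hu)
      · exact Or.inr (Or.inr rfl)
      · exact Or.inr (Or.inl (Fin.rev_rev _))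
    · exact fun u hu => (hRV u hu).mono fun i j hij =>
        ⟨(hRmem i j hij).1, (hRmem i j hij).2, hRA i j hij⟩
  obtain ⟨z, hyz, hzx⟩ := exists_other_neighbor hn hA0 hA1 hyc hyJ x
  have hns : ¬ R y z := by
    rintro (hij | hs | hs)
    · exact hyW hij.1
    · rcases Sym2.eq_iff.1 hs with ⟨h1, h2⟩ | ⟨h1, h2⟩
      · exact hyW (h1 ▸ hxW)
      · exact hzx h2
    · rcases Sym2.eq_iff.1 hs with ⟨h1, h2⟩ | ⟨h1, h2⟩
      · exact hyx h1
      · exact hyy h1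
  refine not_realizes_edge hA hRA hyz hns ?_
  have := hRy.linear (hRV z (hall z (hyJ.tail hyz))) 1 1
  simpa using this

end IsLollipop

end Component

/-! ### Symmetric trails and the three types -/

section Shapes

variable {V β : Type*}

/-- A closed sequence without further repetitions is the sequence of vertices of a cycle. -/
lemma exists_cycle {g : ℕ → V} {k : ℕ} (hk : 0 < k) (hg : g k = g 0)
    (hinj : ∀ a b, a < k → b < k → g a = g b → a = b) :
    ∃ w : ZMod k → V, Function.Injective w ∧ (∀ j : ℕ, j ≤ k → w j = g j) ∧
      (∀ x, x ∈ Set.range w ↔ ∃ j < k, g j = x) ∧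
      (∀ e, e ∈ cycleEdges w ↔ ∃ j < k, s(g j, g (j + 1)) = e) := by
  have : NeZero k := ⟨hk.ne'⟩
  have hw : ∀ j : ℕ, j ≤ k → g (j : ZMod k).val = g j := by
    intro j hj
    rcases hj.eq_or_lt with rfl | hj
    · rw [ZMod.natCast_self, ZMod.val_zero, hg]
    · rw [ZMod.val_natCast, Nat.mod_eq_of_lt hj]
  have hsucc : ∀ z : ZMod k, g (z + 1).val = g (z.val + 1) := by
    intro z
    rw [← hw (z.val + 1) z.val_lt]
    congr 2
    rw [Nat.cast_add, ZMod.natCast_zmod_val, Nat.cast_one]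
  refine ⟨fun z => g z.val, fun a b h => ZMod.val_injective k (hinj _ _ a.val_lt b.val_lt h), hw,
    fun x => ⟨?_, ?_⟩, fun e => ⟨?_, ?_⟩⟩
  · rintro ⟨z, rfl⟩
    exact ⟨z.val, z.val_lt, rfl⟩
  · rintro ⟨j, hj, rfl⟩
    exact ⟨j, hw j hj.le⟩
  · rintro ⟨z, rfl⟩
    exact ⟨z.val, z.val_lt, by simp only [hsucc]⟩
  · rintro ⟨j, hj, rfl⟩
    refine ⟨j, ?_⟩
    simp only [hsucc]
    rw [ZMod.val_natCast, Nat.mod_eq_of_lt hj]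

lemma sym2_congr (q : ℤ → V) {a b c d : ℤ} (h : a = c) (h' : b = d) :
    s(q a, q b) = s(q c, q d) := by
  rw [h, h']

lemma sym2_congr_swap (q : ℤ → V) {a b c d : ℤ} (h : a = d) (h' : b = c) :
    s(q a, q b) = s(q c, q d) := by
  rw [h, h', Sym2.eq_swap]

/-- `H` is the image of the walk `q (-t), …, q t`, where `q` is injective on the open interval
`(-t, t)` and `ρ` reflects the walk. -/
structure IsSymmetricTrail (H : Graph V β) (ρ : V → V) (q : ℤ → V) (t : ℕ) : Prop where
  inj : ∀ a b : ℤ, -t < a → a < t → -t < b → b < t → q a = q b → a = b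
  rev : ∀ a, ρ (q a) = q (-a)
  vertex : ∀ x, x ∈ V(H) ↔ ∃ a : ℤ, -t < a ∧ a < t ∧ q a = x
  adj : ∀ x y, H.Adj x y ↔ ∃ a : ℤ, -t ≤ a ∧ a < t ∧ s(q a, q (a + 1)) = s(x, y)

namespace IsSymmetricTrail

variable {H : Graph V β} {ρ : V → V} {q : ℤ → V} {i t : ℕ}

/-- The last edge joins `q i` to its own reflection `q (-i)`, and closes the segment from `-i` to
`i` into a cycle of length `2 * i + 1`. -/
lemma isTypeA (h : IsSymmetricTrail H ρ q t) (ht : t = i + 1) (hclose : q t = q (-i)) :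
    IsTypeA H (q 0) := by
  have hclose' : q (-t) = q i := by rw [← h.rev, hclose, h.rev, neg_neg]
  obtain ⟨w, hw, -, hwr, hwe⟩ := exists_cycle (g := fun j : ℕ => q (j - i)) (k := 2 * i + 1)
    (by omega) (by
      rw [show ((2 * i + 1 : ℕ) : ℤ) - i = t by omega, hclose]
      simp) (fun a b ha hb hab => by
        have := h.inj _ _ (by omega) (by omega) (by omega) (by omega) hab
        omega)
  refine ⟨_, w, ⟨i, rfl⟩, hw, (hwr _).2 ⟨i, by omega, by simp⟩, ?_, fun x y => ?_⟩
  · ext x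
    rw [h.vertex, hwr]
    constructor
    · rintro ⟨a, h1, h2, rfl⟩
      exact ⟨(a + i).toNat, by omega, by congr 1; omega⟩
    · rintro ⟨j, hj, rfl⟩
      exact ⟨_, by omega, by omega, rfl⟩
  · rw [h.adj, hwe]
    constructor
    · rintro ⟨a, h1, h2, h3⟩
      -- The first and the last step of the trail are the same edge.
      rcases h1.eq_or_lt with h4 | h4
      · refine ⟨2 * i, by omega, ?_⟩
        rw [← h3, ← h4, hclose', show -(t : ℤ) + 1 = -i by omega, ← hclose]
        exact sym2_congr q (by omega) (by omega)
      · refine ⟨(a + i).toNat, by omega, ?_⟩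
        rw [← h3]
        exact sym2_congr q (by omega) (by omega)
    · rintro ⟨j, hj, h3⟩
      refine ⟨j - i, by omega, by omega, ?_⟩
      rw [← h3]
      exact sym2_congr q (by omega) (by omega)

/-- The path through the centre between the vertices `q i` and `q (-i)`. -/
lemma exists_path (h : IsSymmetricTrail H ρ q t) (hit : i < t) :
    ∃ p : Fin (2 * i + 1) → V, Function.Injective p ∧ p 0 = q i ∧ p (Fin.last (2 * i)) = q (-i) ∧
      p ⟨i, by omega⟩ = q 0 ∧ (∀ x, x ∈ Set.range p ↔ ∃ a : ℤ, -i ≤ a ∧ a ≤ i ∧ q a = x) ∧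
      (∀ e, e ∈ pathEdges p ↔ ∃ a : ℤ, -i ≤ a ∧ a < i ∧ s(q a, q (a + 1)) = e) := by
  refine ⟨fun j => q (i - (j : ℕ)), fun a b hab => ?_, ?_, ?_, ?_, fun x => ⟨?_, ?_⟩,
    fun e => ⟨?_, ?_⟩⟩
  · have := h.inj _ _ (by omega) (by omega) (by omega) (by omega) hab
    ext
    omega
  · simp
  · simp only [Fin.val_last]
    congr 1
    omega
  · simp
  · rintro ⟨j, rfl⟩
    exact ⟨_, by omega, by omega, rfl⟩
  · rintro ⟨a, h1, h2, rfl⟩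
    exact ⟨⟨(i - a).toNat, by omega⟩, by simp only; congr 1; omega⟩
  · rintro ⟨j, rfl⟩
    refine ⟨i - (j : ℕ) - 1, by omega, by omega, ?_⟩
    simp only [Fin.val_castSucc, Fin.val_succ]
    exact sym2_congr_swap q (by omega) (by omega)
  · rintro ⟨a, h1, h2, rfl⟩
    refine ⟨⟨(i - a - 1).toNat, by omega⟩, ?_⟩
    simp only [Fin.castSucc_mk, Fin.succ_mk]
    exact sym2_congr_swap q (by omega) (by omega)

/-- The trail closes on the same side of the centre, so the segments `[i, t]` and `[-t, -i]` become
two cycles. The case excluded by `hne` is a loop at the centre, where they coincide. -/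
lemma isTypeB (h : IsSymmetricTrail H ρ q t) (hit : i < t) (hodd : Odd (t - i))
    (hne : ¬ (i = 0 ∧ t = 1)) (hclose : q t = q i) : IsTypeB H (q 0) ρ := by
  have hclose' : q (-t) = q (-i) := by rw [← h.rev, hclose, h.rev]
  obtain ⟨w, hw, hwj, hwr, hwe⟩ := exists_cycle (g := fun j : ℕ => q (i + j)) (k := t - i)
    (by omega) (by
      rw [show (i : ℤ) + (t - i : ℕ) = t by omega, hclose]
      simp) (fun a b ha hb hab => by
        have := h.inj _ _ (by omega) (by omega) (by omega) (by omega) hab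
        omega)
  obtain ⟨w', hw', hwj', hwr', hwe'⟩ := exists_cycle (g := fun j : ℕ => q (-i - j)) (k := t - i)
    (by omega) (by
      rw [show -(i : ℤ) - (t - i : ℕ) = -t by omega, hclose']
      simp) (fun a b ha hb hab => by
        have := h.inj _ _ (by omega) (by omega) (by omega) (by omega) hab
        omega)
  obtain ⟨p, hp, hp0, hpl, hpc, hpr, hpe⟩ := h.exists_path hit
  have hw0 : w 0 = q i := by simpa using hwj 0 (by omega)
  have hw0' : w' 0 = q (-i) := by simpa using hwj' 0 (by omega)
  refine ⟨t - i, i, w, w', p, hodd, hw, hw', hp, ?_, by rw [hp0, hw0], by rw [hpl, hw0'], hpc,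
    ?_, ?_, ?_, ?_, ?_, fun x y => ?_⟩
  · intro heq
    have h1 : q (t - 1) ∈ Set.range w :=
      (hwr _).2 ⟨t - 1 - i, by omega, by congr 1; omega⟩
    rw [heq, hwr'] at h1
    obtain ⟨j, hj, h2⟩ := h1
    have := h.inj _ _ (by omega) (by omega) (by omega) (by omega) h2
    omega
  · ext x
    simp only [Set.mem_inter_iff, Set.mem_singleton_iff, hwr, hpr, hw0]
    constructor
    · rintro ⟨⟨j, hj, rfl⟩, a, h1, h2, h3⟩
      have := h.inj _ _ (by omega) (by omega) (by omega) (by omega) h3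
      congr 1
      omega
    · rintro rfl
      exact ⟨⟨0, by omega, by simp⟩, i, by omega, by omega, rfl⟩
  · ext x
    simp only [Set.mem_inter_iff, Set.mem_singleton_iff, hwr', hpr, hw0']
    constructor
    · rintro ⟨⟨j, hj, rfl⟩, a, h1, h2, h3⟩
      have := h.inj _ _ (by omega) (by omega) (by omega) (by omega) h3
      congr 1
      omega
    · rintro rfl
      exact ⟨⟨0, by omega, by simp⟩, -i, by omega, by omega, rfl⟩
  · rintro x ⟨h1, h2⟩
    obtain ⟨a, ha, rfl⟩ := (hwr _).1 h1
    obtain ⟨b, hb, hab⟩ := (hwr' _).1 h2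
    have := h.inj _ _ (by omega) (by omega) (by omega) (by omega) hab
    exact (hpr _).2 ⟨i + a, by omega, by omega, rfl⟩
  · intro _
    ext x
    rw [hwr']
    constructor
    · rintro ⟨y, hy, rfl⟩
      obtain ⟨j, hj, rfl⟩ := (hwr _).1 hy
      exact ⟨j, hj, by rw [h.rev]; congr 1; omega⟩
    · rintro ⟨j, hj, rfl⟩
      exact ⟨q (i + j), (hwr _).2 ⟨j, hj, rfl⟩, by rw [h.rev]; congr 1; omega⟩
  · ext x
    simp only [Set.mem_union, h.vertex, hwr, hwr', hpr]
    constructor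
    · rintro ⟨a, h1, h2, rfl⟩
      rcases le_or_gt (i : ℤ) a with h3 | h3
      · exact Or.inl (Or.inl ⟨(a - i).toNat, by omega, by congr 1; omega⟩)
      · rcases le_or_gt a (-i) with h4 | h4
        · exact Or.inl (Or.inr ⟨(-i - a).toNat, by omega, by congr 1; omega⟩)
        · exact Or.inr ⟨a, by omega, by omega, rfl⟩
    · rintro ((⟨j, hj, rfl⟩ | ⟨j, hj, rfl⟩) | ⟨a, h1, h2, rfl⟩)
      · exact ⟨_, by omega, by omega, rfl⟩
      · exact ⟨_, by omega, by omega, rfl⟩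
      · exact ⟨a, by omega, by omega, rfl⟩
  · simp only [Set.mem_union, h.adj, hwe, hwe', hpe]
    constructor
    · rintro ⟨a, h1, h2, h3⟩
      rw [← h3]
      rcases le_or_gt (i : ℤ) a with h4 | h4
      · refine Or.inl (Or.inl ⟨(a - i).toNat, by omega, ?_⟩)
        exact sym2_congr q (by omega) (by omega)
      · rcases lt_or_ge a (-i) with h5 | h5
        · refine Or.inl (Or.inr ⟨(-i - a - 1).toNat, by omega, ?_⟩)
          exact sym2_congr_swap q (by omega) (by omega)
        · exact Or.inr ⟨a, by omega, by omega, rfl⟩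
    · rintro ((⟨j, hj, h3⟩ | ⟨j, hj, h3⟩) | ⟨a, h1, h2, h3⟩)
      · refine ⟨i + j, by omega, by omega, ?_⟩
        rw [← h3]
        exact sym2_congr q (by omega) (by omega)
      · refine ⟨-i - j - 1, by omega, by omega, ?_⟩
        rw [← h3]
        exact sym2_congr_swap q (by omega) (by omega)
      · exact ⟨a, by omega, by omega, h3⟩

/-- The trail closes on the opposite side of the centre, so the segments `[i, t]` and `[-t, -i]` are
glued at both ends and become the two halves of one cycle. -/
lemma isTypeC (h : IsSymmetricTrail H ρ q t) (hi : 1 ≤ i) (hit : i + 2 ≤ t)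
    (hclose : q t = q (-i)) : IsTypeC H (q 0) ρ := by
  have hclose' : q (-t) = q i := by rw [← h.rev, hclose, h.rev, neg_neg]
  obtain ⟨m, rfl⟩ := Nat.exists_eq_add_of_le (show i ≤ t by omega)
  -- The cycle runs from `i` up to `t`, then from `-i` down to `-t`; the two descriptions agree at
  -- `j = m` by `hclose`.
  obtain ⟨g, hg1, hg2⟩ : ∃ g : ℕ → V, (∀ j ≤ m, g j = q (i + j)) ∧ ∀ j, g (m + j) = q (-i - j) := by
    refine ⟨fun j => if j < m then q (i + j) else q (-i - (j - m : ℕ)), fun j hj => ?_, fun j => ?_⟩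
    · rcases hj.eq_or_lt with rfl | hj
      · simp only [lt_irrefl, if_false, Nat.sub_self]
        push_cast at hclose
        rw [hclose]
        simp
      · simp only [if_pos hj]
    · simp
  have hg3 : ∀ j, m ≤ j → g j = q (-i - (j - m : ℕ)) := fun j hj => by
    rw [← hg2]
    congr 1
    omega
  obtain ⟨w, hw, hwj, hwr, hwe⟩ := exists_cycle (g := g) (k := 2 * m)
    (by omega) (by
      rw [two_mul, hg2, hg1 0 (by omega), show -(i : ℤ) - m = -(i + m : ℕ) by omega, hclose']
      simp) (fun a b ha hb hab => by
        rcases lt_or_ge a m with h1 | h1 <;> rcases lt_or_ge b m with h2 | h2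
        · rw [hg1 a h1.le, hg1 b h2.le] at hab
          have := h.inj _ _ (by omega) (by omega) (by omega) (by omega) hab
          omega
        · rw [hg1 a h1.le, hg3 b h2] at hab
          have := h.inj _ _ (by omega) (by omega) (by omega) (by omega) hab
          omega
        · rw [hg3 a h1, hg1 b h2.le] at hab
          have := h.inj _ _ (by omega) (by omega) (by omega) (by omega) hab
          omega
        · rw [hg3 a h1, hg3 b h2] at hab
          have := h.inj _ _ (by omega) (by omega) (by omega) (by omega) hab
          omega)
  obtain ⟨p, hp, hp0, hpl, hpc, hpr, hpe⟩ := h.exists_path (i := i) (by omega)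
  have hw0 : w 0 = q i := by simpa [hg1 0 (by omega)] using hwj 0 (by omega)
  have hwm : w (m : ZMod (2 * m)) = q (-i) := by
    rw [hwj m (by omega), hg3 m le_rfl]
    simp
  have hrev : ∀ j ≤ m, ρ (g j) = g (m + j) := fun j hj => by
    rw [hg1 j hj, hg2, h.rev]
    congr 1
    omega
  refine ⟨m, i, w, p, by omega, hi, hw, hp, by rw [hp0, hw0], by rw [hpl, hwm], hpc, ?_, ?_, ?_,
    fun x y => ?_⟩
  · ext x
    simp only [Set.mem_inter_iff, Set.mem_insert_iff, Set.mem_singleton_iff, hwr, hpr, hw0, hwm]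
    constructor
    · rintro ⟨⟨j, hj, rfl⟩, a, h1, h2, h3⟩
      rcases lt_or_ge j m with h4 | h4
      · rw [hg1 j h4.le] at h3 ⊢
        have := h.inj _ _ (by omega) (by omega) (by omega) (by omega) h3
        left
        congr 1
        omega
      · rw [hg3 j h4] at h3 ⊢
        have := h.inj _ _ (by omega) (by omega) (by omega) (by omega) h3
        right
        congr 1
        omega
    · rintro (rfl | rfl)
      · exact ⟨⟨0, by omega, by rw [hg1 0 (by omega)]; simp⟩, i, by omega, by omega, rfl⟩
      · exact ⟨⟨m, by omega, by rw [hg3 m le_rfl]; simp⟩, -i, by omega, by omega, rfl⟩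
  · ext x
    constructor
    · rintro ⟨_, ⟨j, ⟨-, hj⟩, rfl⟩, rfl⟩
      refine ⟨m + j, ⟨by omega, by omega⟩, ?_⟩
      simp only
      rw [hwj j (by omega), hrev j hj, hwj _ (by omega)]
    · rintro ⟨j, ⟨hj1, hj2⟩, rfl⟩
      refine ⟨_, ⟨j - m, ⟨by omega, by omega⟩, rfl⟩, ?_⟩
      simp only
      rw [hwj (j - m) (by omega), hrev _ (by omega), hwj j hj2]
      congr 1
      omega
  · ext x
    simp only [Set.mem_union, h.vertex, hwr, hpr]
    constructor
    · rintro ⟨a, h1, h2, rfl⟩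
      rcases le_or_gt (i : ℤ) a with h3 | h3
      · exact Or.inl ⟨(a - i).toNat, by omega, by rw [hg1 _ (by omega)]; congr 1; omega⟩
      · rcases le_or_gt a (-i) with h4 | h4
        · exact Or.inl ⟨m + (-i - a).toNat, by omega, by rw [hg2]; congr 1; omega⟩
        · exact Or.inr ⟨a, by omega, by omega, rfl⟩
    · rintro (⟨j, hj, rfl⟩ | ⟨a, h1, h2, rfl⟩)
      · rcases lt_or_ge j m with h4 | h4
        · exact ⟨_, by omega, by omega, (hg1 j h4.le).symm⟩
        · exact ⟨_, by omega, by omega, (hg3 j h4).symm⟩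
      · exact ⟨a, by omega, by omega, rfl⟩
  · simp only [Set.mem_union, h.adj, hwe, hpe]
    constructor
    · rintro ⟨a, h1, h2, h3⟩
      rw [← h3]
      rcases le_or_gt (i : ℤ) a with h4 | h4
      · refine Or.inl ⟨(a - i).toNat, by omega, ?_⟩
        rw [hg1 _ (by omega), hg1 _ (by omega)]
        exact sym2_congr q (by omega) (by omega)
      · rcases lt_or_ge a (-i) with h5 | h5
        · refine Or.inl ⟨m + (-i - a - 1).toNat, by omega, ?_⟩
          rw [add_assoc, hg2, hg2]
          exact sym2_congr_swap q (by omega) (by omega)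
        · exact Or.inr ⟨a, by omega, by omega, rfl⟩
    · rintro (⟨j, hj, h3⟩ | ⟨a, h1, h2, h3⟩)
      · rw [← h3]
        rcases lt_or_ge j m with h4 | h4
        · refine ⟨i + j, by omega, by omega, ?_⟩
          rw [hg1 _ (by omega), hg1 _ (by omega)]
          exact sym2_congr q (by omega) (by omega)
        · refine ⟨-i - (j - m : ℕ) - 1, by omega, by omega, ?_⟩
          rw [hg3 _ (by omega), hg3 _ (by omega)]
          exact sym2_congr_swap q (by omega) (by omega)
      · exact ⟨a, by omega, by omega, h3⟩

end IsSymmetricTrail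

end Shapes

/-! ### The component of the centre in an extreme point -/

section Forward

variable {n : ℕ}

theorem isCentralType_of_mem_extremePoints (hn : Odd n) {A : Matrix (Fin n) (Fin n) ℝ}
    (hA : A ∈ Set.extremePoints ℝ (OmegaTH n)) :
    IsCentralType hn (componentOf (loopyGraph A) (centralVertex hn)) := by
  obtain ⟨hA0, hA1⟩ := mem_OmegaTH_iff.1 hA.1
  obtain ⟨v, i, t, h⟩ := exists_isLollipop hn hA0 hA1
  have hodd := h.odd hA
  have hlt := h.lt
  -- The lollipop is unfolded about the centre, with the reflected walk on the negative side.
  obtain ⟨q, hq1, hq2⟩ : ∃ q : ℤ → Fin n, (∀ j : ℕ, q j = v j) ∧ ∀ j : ℕ, q (-j) = (v j).rev := by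
    refine ⟨fun a => if 0 ≤ a then v a.toNat else (v (-a).toNat).rev, fun j => by simp, fun j => ?_⟩
    rcases Nat.eq_zero_or_pos j with rfl | hj
    · simp [h.zero, rev_centralVertex hn]
    · simp [hj.ne']
  have hrev : ∀ a, (q a).rev = q (-a) := by
    intro a
    rcases Int.eq_nat_or_neg a with ⟨j, rfl | rfl⟩
    · rw [hq1, hq2]
    · rw [hq2, neg_neg, hq1, Fin.rev_rev]
  have hq0 : q 0 = centralVertex hn := by rw [← h.zero, ← hq1]; rfl
  -- The orbit of the `j`-th edge of the walk consists of the trail edges with indices `j` and `-j -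
  -- 1`.
  have hsame : ∀ x y (j : ℕ), SameOrbit x y (v j) (v (j + 1)) ↔
      s(q j, q (j + 1)) = s(x, y) ∨ s(q (-j - 1), q (-j - 1 + 1)) = s(x, y) := by
    intro x y j
    rw [SameOrbit, ← hq1 j, ← hq1 (j + 1), hrev, hrev, Sym2.eq_swap (a := q (-(j : ℤ) - 1))]
    push_cast
    rw [show -(j : ℤ) - 1 + 1 = -j by ring, show -(j : ℤ) - 1 = -(j + 1) by ring]
    exact or_congr eq_comm eq_comm
  have hreach : ∀ x, GraphReachable (loopyGraph A) (centralVertex hn) x ↔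
      x ∈ IsLollipop.support v t := by
    intro x
    rw [← h.joined_iff_mem_support hA, GraphReachable, EntryReachable]
    have : (loopyGraph A).Adj = fun x y => A x y ≠ 0 := by
      ext x y
      exact loopyGraph_adj hA1 x y
    rw [this]
  have hS : IsSymmetricTrail (componentOf (loopyGraph A) (centralVertex hn)) Fin.rev q t := by
    refine ⟨fun a b ha ha' hb hb' hab => ?_, hrev, fun x => ?_, fun x y => ?_⟩
    · rcases Int.eq_nat_or_neg a with ⟨c, rfl | rfl⟩ <;>
        rcases Int.eq_nat_or_neg b with ⟨d, rfl | rfl⟩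
      · rw [hq1, hq1] at hab
        rw [h.eq_of_orbit (by omega) (by omega) (Or.inl hab)]
      · rw [hq1, hq2] at hab
        have hcd := h.eq_of_orbit (by omega) (by omega) (Or.inr hab)
        subst hcd
        have := h.eq_zero (by omega) ((rev_eq_self_iff hn _).1 hab.symm)
        omega
      · rw [hq1, hq2] at hab
        have hcd := h.eq_of_orbit (by omega) (by omega) (Or.inr hab.symm)
        subst hcd
        have := h.eq_zero (by omega) ((rev_eq_self_iff hn _).1 hab)
        omega
      · rw [hq2, hq2] at hab
        rw [h.eq_of_orbit (by omega) (by omega) (Or.inl (Fin.rev_injective hab))]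
    · change GraphReachable (loopyGraph A) (centralVertex hn) x ↔ _
      rw [hreach]
      constructor
      · rintro ⟨j, hj, rfl | rfl⟩
        · exact ⟨j, by omega, by omega, hq1 j⟩
        · exact ⟨-j, by omega, by omega, hq2 j⟩
      · rintro ⟨a, h1, h2, rfl⟩
        rcases Int.eq_nat_or_neg a with ⟨j, rfl | rfl⟩
        · exact ⟨j, by omega, Or.inl (hq1 j)⟩
        · exact ⟨j, by omega, Or.inr (hq2 j)⟩
    · have h1 : (componentOf (loopyGraph A) (centralVertex hn)).Adj x y ↔
          A x y ≠ 0 ∧ x ∈ IsLollipop.support v t ∧ y ∈ IsLollipop.support v t := by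
        rw [← hreach, ← hreach, ← loopyGraph_adj hA1]
        constructor
        · rintro ⟨e, h1, h2, h3⟩
          exact ⟨⟨e, h1⟩, h2, h3⟩
        · rintro ⟨⟨e, h1⟩, h2, h3⟩
          exact ⟨e, h1, h2, h3⟩
      have h2 : A x y ≠ 0 ∧ x ∈ IsLollipop.support v t ∧ y ∈ IsLollipop.support v t ↔
          WalkEdge v 0 t x y := by
        constructor
        · rintro ⟨h2, h3, h4⟩
          exact (h.ne_zero_iff_walkEdge hA h3 h4).1 h2
        · intro h2
          refine ⟨h.ne_zero_of_walkEdge hA1 h2, h.mem_support_of_walkEdge h2,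
            h.mem_support_of_walkEdge (y := x) ?_⟩
          obtain ⟨j, h3, h4, h5⟩ := h2
          exact ⟨j, h3, h4, h5.swap⟩
      rw [h1, h2]
      constructor
      · rintro ⟨j, -, hj, hs⟩
        rcases (hsame x y j).1 hs with hs | hs
        · exact ⟨j, by omega, by omega, hs⟩
        · exact ⟨-j - 1, by omega, by omega, hs⟩
      · rintro ⟨a, ha1, ha2, hs⟩
        rcases le_or_gt 0 a with h3 | h3
        · obtain ⟨j, rfl⟩ := Int.eq_ofNat_of_zero_le h3
          exact ⟨j, Nat.zero_le _, by omega, (hsame x y j).2 (Or.inl hs)⟩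
        · obtain ⟨j, hj⟩ := Int.eq_ofNat_of_zero_le (show 0 ≤ -a - 1 by omega)
          have : a = -j - 1 := by omega
          subst this
          exact ⟨j, Nat.zero_le _, by omega, (hsame x y j).2 (Or.inr hs)⟩
  rw [IsCentralType]
  have hclose := h.close
  rw [← hq1, ← hq1, hrev] at hclose
  -- For `i = 0` the two ways of closing coincide: `t = 1` is a loop at the centre, of type (a), and
  -- a larger `t` gives type (b).
  by_cases h1 : t = i + 1 ∧ q t = q (-i)
  · exact Or.inl (hq0 ▸ hS.isTypeA h1.1 h1.2)
  by_cases h2 : q t = q i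
  · refine Or.inr (Or.inl (hq0 ▸ hS.isTypeB hlt hodd ?_ h2))
    rintro ⟨rfl, rfl⟩
    exact h1 ⟨rfl, by simpa using h2⟩
  · have h3 := hclose.resolve_left h2
    have hC := hS.isTypeC (i := i) ?_ ?_ h3
    · exact Or.inr (Or.inr (hq0 ▸ hC))
    · rw [Nat.one_le_iff_ne_zero]
      rintro rfl
      exact h2 (by simpa using h3)
    · have : t ≠ i + 1 := fun h4 => h1 ⟨h4, h3⟩
      omega

end Forward

theorem mainTheorem2 (n : ℕ) (hn : Odd n) :
    (∀ A ∈ Set.extremePoints ℝ (OmegaTH n),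
      IsCentralType hn (componentOf (loopyGraph A) (centralVertex hn))) ∧
    (∀ A ∈ OmegaTH n, GraphConnected (loopyGraph A) → IsCentralType hn (loopyGraph A) →
      A ∈ Set.extremePoints ℝ (OmegaTH n)) :=
  ⟨fun _ hA => isCentralType_of_mem_extremePoints hn hA,
    fun _ hA _ h => mem_extremePoints_of_isCentralType hn hA h⟩
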